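/- For an even integer $k$ let $S_k$ be the space of holomorphic cusp forms of weight $k$ for $\Gamma=\mathrm{SL}(2,\mathbb{Z})$, with the Petersson inner product $\langle f,g\rangle=\int_{\Gamma\backslash\mathbb{H}} f(z)\overline{g(z)}\,y^k\,\frac{dx\,dy}{y^2}$, and let $\mathcal{B}_k$ be an orthonormal basis of $S_k$. For $y>0$ let $\mu_k^+$ be the measure on $\mathbb{R}/\mathbb{Z}$ given by $$d\mu_k^+ = \frac{1}{|\mathcal{B}_k|}\sum_{f\in\mathcal{B}_k} y^k\,|f(x+iy)|^2\,dx .$$ There are absolute positive constants $A_0, Y_0, C, k_0$ such that the following holds for all real $A\ge A_0$, all real $Y\ge Y_0$, all even integers $k\ge k_0$, every orthonormal basis $\mathcal{B}_k$ of $S_k$, every $y$ with $$Y^{-1}<y<k^{1/2}(17A\log k)^{-1/2},$$ and every integrable function $\psi:\mathbb{R}/\mathbb{Z}\to\mathbb{C}$: the function $\psi$ is integrable with respect to $\mu_k^+$, and $$\left|\int_{\mathbb{R}/\mathbb{Z}}\psi\,d\mu_k^+ - \frac{3}{\pi}\int_{\mathbb{R}/\mathbb{Z}}\psi(x)\,dx\right|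 \le C\,\|\psi\|_\infty\,Y^2\,k^{-1/2}(\log k)^{1/2},$$ where $\|\psi\|_\infty$ is the essential supremum of $|\psi|$ (the bound says nothing if it is infinite). -/

import Mathlib

open MeasureTheory
open scoped MatrixGroups Modular ENNReal

noncomputable section

namespace ModularAverage

/-- The Petersson inner product `∫_X f(z) conj(g(z)) y ^ k dx dy / y ^ 2` on the cusp forms of
weight `k` for `SL(2, ℤ)`. The integral is over the standard fundamental domain `𝒟`, and the
volume on `ℍ` is the (not normalized) hyperbolic measure `dx dy / y ^ 2`. -/
def peterssonInner {k : ℤ} (f g : CuspForm 𝒮ℒ k) : ℂ :=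
  ∫ z in 𝒟, UpperHalfPlane.petersson k g f z

/-- `B` is an orthonormal basis of the space of cusp forms of weight `k` for `SL(2, ℤ)`, with
respect to the Petersson inner product. -/
structure IsOrthonormalBasis {k : ℤ} (B : Finset (CuspForm 𝒮ℒ k)) : Prop where
  norm_one : ∀ f ∈ B, peterssonInner f f = 1
  orthogonal : ∀ f ∈ B, ∀ g ∈ B, f ≠ g → peterssonInner f g = 0
  span_eq_top : Submodule.span ℂ (B : Set (CuspForm 𝒮ℒ k)) = ⊤

/-- The point `x + i y` of the upper half-plane. -/
def point (y : ℝ) (hy : 0 < y) (x : ℝ) : UpperHalfPlane :=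
  ⟨x + y * Complex.I, by simpa using hy⟩

/-- The function `x ↦ |B|⁻¹ ∑_{f ∈ B} y ^ k |f(x + i y)| ^ 2`. -/
def density {k : ℕ} (B : Finset (CuspForm 𝒮ℒ (k : ℤ))) (y : ℝ) (hy : 0 < y) (x : ℝ) : ℝ :=
  (B.card : ℝ)⁻¹ * ∑ f ∈ B, y ^ k * ‖f (point y hy x)‖ ^ 2

theorem density_periodic {k : ℕ} (B : Finset (CuspForm 𝒮ℒ (k : ℤ))) (y : ℝ) (hy : 0 < y) :
    Function.Periodic (density B y hy) 1 := by
  intro x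
  have h : point y hy (x + 1) = (1 : ℝ) +ᵥ point y hy x := by
    ext
    simp [point]
    ring
  have hf : ∀ f : CuspForm 𝒮ℒ (k : ℤ), f (point y hy (x + 1)) = f (point y hy x) := fun f => by
    rw [h]
    exact SlashInvariantForm.vAdd_apply_of_mem_strictPeriods f (point y hy x) (by simp)
  simp only [density, hf]

/-- The measure `|B|⁻¹ ∑_{f ∈ B} y ^ k |f(x + i y)| ^ 2 dx` on `ℝ / ℤ`, where `dx` is the
Lebesgue measure of total mass `1`. -/
def horizontalMeasure {k : ℕ} (B : Finset (CuspForm 𝒮ℒ (k : ℤ))) (y : ℝ) (hy : 0 < y) :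
    Measure UnitAddCircle :=
  volume.withDensity fun t => ENNReal.ofReal ((density_periodic B y hy).lift t)

end ModularAverage

end

/-! ### Weighted mean value property on the unit disc -/

noncomputable section

namespace ModularAverage

/-! Write k = 2m. The sum of y ^ k |f(z)| ^ 2 over an orthonormal basis is the Bergman kernel on the
diagonal. `bergman_kernel_eq` expands it as (k - 1) / (8π) times a sum over γ in SL(2, ℤ) of terms
whose modulus is cosh(d(z, γz) / 2) ^ (-k) = `coshSq z γ ^ (-m)`. The elements 1 and -1 contribute
exactly (k - 1) / (4π). Since |B| = k / 12 + O(1) (`finrank_cuspForm_bounds`), dividing by |B|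
leaves 3 / π + O(1 / k).

The expansion rests on the reproducing property of (τ - z̄) ^ (-k) on the upper half-plane. After a
Cayley transform it is the mean value property with weight (1 - |s|²) ^ (k - 2). Unfolding
(`integral_fd_tsum`) transfers it to the Poincaré series, whose coefficients in the basis are then
multiples of the conjugates of f(z).

It remains to bound the other γ = (a, b; c, d). If c = 0, then `coshSq` is 1 + b² / (4y²), and the
upper bound on y makes these terms negligible at every point (`tsum_eq_zero_le`). If c ≠ 0, no
pointwise bound is sought, only one for the integral over x (`lintegral_tsum_ne_zero_le`). With t =
a + d and u = cx - (a - d) / 2, a term is at most a constant times (cy)⁻² (1 + t²)⁻¹ (1 + mu²)⁻¹.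
For fixed c and t, integrating over x and summing over a unfolds to the integral of (1 + mu²)⁻¹ over
the line, which is π / √m. The total is O(y⁻² k^(-1/2)), hence O(Y² k^(-1/2)).

So the density is close to 3 / π in L¹, and ψ enters only through its essential supremum
(`enorm_integral_sub_le`). This argument does not need the factor (log k)^(1/2). -/

open Metric Set in
lemma integral_mul_one_sub_sq_pow (m : ℕ) :
    ∫ r in Ioo (0 : ℝ) 1, r * (1 - r ^ 2) ^ m = 1 / (2 * (m + 1 : ℝ)) := by
  rw [← integral_Ioc_eq_integral_Ioo, ← intervalIntegral.integral_of_le zero_le_one]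
  have h : ∀ r ∈ uIcc (0 : ℝ) 1, HasDerivAt
      (fun r : ℝ => -((1 - r ^ 2) ^ (m + 1)) / (2 * (m + 1))) (r * (1 - r ^ 2) ^ m) r := by
    intro r _
    have h1 : HasDerivAt (fun r : ℝ => 1 - r ^ 2) (-(2 * r)) r := by
      simpa using (hasDerivAt_pow 2 r).const_sub 1
    refine (((h1.fun_pow (m + 1)).fun_neg).div_const (2 * (m + 1 : ℝ))).congr_deriv ?_
    have : (m : ℝ) + 1 ≠ 0 := by positivity
    push_cast
    field_simp
  rw [intervalIntegral.integral_eq_sub_of_hasDerivAt h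
    ((by fun_prop : Continuous fun r : ℝ => r * (1 - r ^ 2) ^ m).intervalIntegrable _ _)]
  simp
  field_simp

open Metric Set in
/-- A holomorphic function on the unit disc has its central value as its average with respect to
a weight `(1 - |ζ| ^ 2) ^ m`. -/
theorem integral_ball_mul_weight {g : ℂ → ℂ} (hg : DifferentiableOn ℂ g (ball 0 1)) (m : ℕ)
    {M : ℝ} (hM : ∀ ζ ∈ ball (0 : ℂ) 1, ‖g ζ * ((1 - ‖ζ‖ ^ 2 : ℝ) : ℂ) ^ m‖ ≤ M) :
    ∫ ζ in ball (0 : ℂ) 1, g ζ * ((1 - ‖ζ‖ ^ 2 : ℝ) : ℂ) ^ m = Real.pi / (m + 1) * g 0 := by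
  rw [← integral_indicator measurableSet_ball, ← Complex.integral_comp_polarCoord_symm]
  set F : ℝ × ℝ → ℂ := fun p =>
    ((p.1 * (1 - p.1 ^ 2) ^ m : ℝ) : ℂ) * g (circleMap 0 p.1 p.2) with hF
  have hcm : ∀ p : ℝ × ℝ, Complex.polarCoord.symm p = circleMap 0 p.1 p.2 := by
    intro p
    simp [circleMap, Complex.exp_mul_I]
  have hstep : ∫ p in polarCoord.target, p.1 • (ball (0 : ℂ) 1).indicator
        (fun ζ => g ζ * ((1 - ‖ζ‖ ^ 2 : ℝ) : ℂ) ^ m) (Complex.polarCoord.symm p) =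
      ∫ p in Ioo (0 : ℝ) 1 ×ˢ Ioo (-Real.pi) Real.pi, F p := by
    rw [← integral_indicator polarCoord.open_target.measurableSet,
      ← integral_indicator (measurableSet_Ioo.prod measurableSet_Ioo)]
    congr 1
    ext p
    by_cases hp : p ∈ polarCoord.target
    · rw [indicator_of_mem hp]
      obtain ⟨hp1, hp2⟩ : 0 < p.1 ∧ p.2 ∈ Ioo (-Real.pi) Real.pi := hp
      by_cases h1 : p.1 < 1
      · rw [indicator_of_mem (by simpa [hcm, abs_of_pos hp1] using h1),
          indicator_of_mem (show p ∈ Ioo (0 : ℝ) 1 ×ˢ Ioo (-Real.pi) Real.pi from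
            ⟨⟨hp1, h1⟩, hp2⟩), hF, hcm]
        simp [abs_of_pos hp1]
        ring
      · rw [indicator_of_notMem (by simpa [hcm, abs_of_pos hp1] using h1),
          indicator_of_notMem (fun h => h1 h.1.2), smul_zero]
    · rw [indicator_of_notMem hp, indicator_of_notMem]
      exact fun h => hp ⟨h.1.1, h.2⟩
  have hmem : ∀ p ∈ Ioo (0 : ℝ) 1 ×ˢ Ioo (-Real.pi) Real.pi, circleMap 0 p.1 p.2 ∈ ball (0 : ℂ) 1 := by
    rintro p ⟨h1, -⟩
    simpa [abs_of_pos h1.1] using h1.2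
  have hcont : ContinuousOn F (Ioo (0 : ℝ) 1 ×ˢ Ioo (-Real.pi) Real.pi) := by
    refine ContinuousOn.mul (by fun_prop) (hg.continuousOn.comp ?_ hmem)
    unfold circleMap
    fun_prop
  -- Fubini needs integrability, but `g` may be unbounded near the circle. Only its product with the
  -- weight is bounded, by `M`.
  have hint : IntegrableOn F (Ioo (0 : ℝ) 1 ×ˢ Ioo (-Real.pi) Real.pi) := by
    refine IntegrableOn.of_bound ?_
      (hcont.aestronglyMeasurable (measurableSet_Ioo.prod measurableSet_Ioo)) M ?_
    · rw [Measure.volume_eq_prod, Measure.prod_prod]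
      exact ENNReal.mul_lt_top (by simp) (by simp)
    · refine (ae_restrict_mem (measurableSet_Ioo.prod measurableSet_Ioo)).mono fun p hp => ?_
      have h := hM _ (hmem p hp)
      have hp1 := hp.1
      simp only [norm_circleMap_zero, sq_abs, norm_mul, norm_pow, Complex.norm_real] at h
      refine le_trans ?_ h
      rw [hF]
      simp only [norm_mul, Complex.norm_real, norm_pow]
      rw [mul_comm]
      gcongr
      exact mul_le_of_le_one_left (by positivity) (by simp [abs_of_pos hp1.1, hp1.2.le])
  -- The weight is constant on each circle, so the mean value property yields `g 0` there.
  have hinner : ∀ r ∈ Ioo (0 : ℝ) 1, ∫ θ in Ioo (-Real.pi) Real.pi, F (r, θ) =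
      ((r * (1 - r ^ 2) ^ m : ℝ) : ℂ) * (2 * Real.pi * g 0) := by
    intro r hr
    have hdiff : DiffContOnCl ℂ g (ball 0 |r|) := by
      rw [abs_of_pos hr.1]
      exact (hg.mono (closedBall_subset_ball hr.2)).diffContOnCl_ball subset_rfl
    have hav := hdiff.circleAverage
    rw [Real.circleAverage_def] at hav
    have hper : Function.Periodic (fun θ => g (circleMap 0 r θ)) (2 * Real.pi) :=
      (periodic_circleMap 0 r).comp g
    have h2 := hper.intervalIntegral_add_eq (-Real.pi) 0
    simp only [hF]
    rw [integral_const_mul, ← integral_Ioc_eq_integral_Ioo,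
      ← intervalIntegral.integral_of_le (by linarith [Real.pi_pos])]
    rw [show -Real.pi + 2 * Real.pi = Real.pi by ring, zero_add] at h2
    rw [h2, ← hav]
    have := Real.pi_pos.ne'
    simp only [Complex.real_smul]
    push_cast
    field_simp
  rw [hstep, Measure.volume_eq_prod, setIntegral_prod F hint,
    setIntegral_congr_fun measurableSet_Ioo hinner, integral_mul_const, integral_complex_ofReal,
    integral_mul_one_sub_sq_pow]
  push_cast
  field_simp

end ModularAverage

end

/-! ### The reproducing kernel of the upper half-plane -/

noncomputable section

namespace ModularAverage

open UpperHalfPlane Set Metric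
open scoped ComplexConjugate Manifold

lemma measurable_inv_im_sq :
    Measurable fun z : ℍ => (1 / NNReal.mk z.im z.im_pos.le : NNReal) ^ 2 := by
  refine Continuous.measurable (.pow (.div₀ continuous_const ?_ ?_) _)
  · exact continuous_im.subtype_mk _
  · exact fun x ↦ NNReal.ne_iff.mp x.im_ne_zero

lemma range_coe_eq : range UpperHalfPlane.coe = {w : ℂ | 0 < w.im} := by
  ext w
  exact ⟨fun ⟨τ, h⟩ => h ▸ τ.im_pos, fun h => ⟨⟨w, h⟩, rfl⟩⟩

/-- The hyperbolic integral in terms of Lebesgue measure on the complex plane. -/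
theorem integral_eq_integral_im_pos (F : ℍ → ℂ) :
    ∫ τ, F τ = ∫ w in {w : ℂ | 0 < w.im}, ((1 / w.im) ^ 2 : ℝ) • F (ofComplex w) := by
  rw [volume_def, integral_withDensity_eq_integral_smul measurable_inv_im_sq, ← range_coe_eq,
    ← measurableEmbedding_coe.map_comap, measurableEmbedding_coe.integral_map]
  refine integral_congr_ae (.of_forall fun τ => ?_)
  simp only [ofComplex_apply, NNReal.smul_def]
  rfl

theorem integrable_iff_integrableOn_im_pos (F : ℍ → ℂ) :
    Integrable F ↔
      IntegrableOn (fun w : ℂ => ((1 / w.im) ^ 2 : ℝ) • F (ofComplex w)) {w : ℂ | 0 < w.im} := by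
  rw [volume_def, integrable_withDensity_iff_integrable_smul measurable_inv_im_sq, ← range_coe_eq,
    IntegrableOn, ← measurableEmbedding_coe.map_comap, measurableEmbedding_coe.integrable_map_iff]
  refine integrable_congr (.of_forall fun τ => ?_)
  simp only [Function.comp, ofComplex_apply, NNReal.smul_def]
  rfl

/-- The biholomorphic map from the unit disc to the upper half-plane that maps `0` to `z`. -/
def cayley (z : ℍ) (s : ℂ) : ℂ := (z - conj (z : ℂ) * s) / (1 - s)

lemma one_sub_ne_zero_of_mem_ball {s : ℂ} (hs : s ∈ ball (0 : ℂ) 1) : 1 - s ≠ 0 := by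
  intro h
  rw [← sub_eq_zero.mp h] at hs
  simp at hs

lemma one_sub_norm_sq_pos {s : ℂ} (hs : s ∈ ball (0 : ℂ) 1) : 0 < 1 - ‖s‖ ^ 2 := by
  rw [mem_ball_zero_iff] at hs
  nlinarith [norm_nonneg s]

lemma cayley_sub_conj (z : ℍ) {s : ℂ} (hs : s ∈ ball (0 : ℂ) 1) :
    cayley z s - conj (z : ℂ) = 2 * z.im * Complex.I / (1 - s) := by
  have h := one_sub_ne_zero_of_mem_ball hs
  have h2 : (z : ℂ) - conj (z : ℂ) = 2 * z.im * Complex.I := by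
    rw [Complex.sub_conj]
    simp
  rw [cayley, ← h2]
  field_simp
  ring

lemma cayley_im (z : ℍ) {s : ℂ} (hs : s ∈ ball (0 : ℂ) 1) :
    (cayley z s).im = z.im * (1 - ‖s‖ ^ 2) / ‖1 - s‖ ^ 2 := by
  have h := one_sub_ne_zero_of_mem_ball hs
  have h' : Complex.normSq (1 - s) ≠ 0 := by simpa using h
  rw [cayley, Complex.div_im, ← Complex.normSq_eq_norm_sq, ← Complex.normSq_eq_norm_sq]
  field_simp
  simp [Complex.normSq_apply]
  ring

lemma cayley_im_pos (z : ℍ) {s : ℂ} (hs : s ∈ ball (0 : ℂ) 1) : 0 < (cayley z s).im := by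
  rw [cayley_im z hs]
  have := norm_pos_iff.mpr (one_sub_ne_zero_of_mem_ball hs)
  have := one_sub_norm_sq_pos hs
  have := z.im_pos
  positivity

lemma injOn_cayley (z : ℍ) : InjOn (cayley z) (ball 0 1) := by
  intro s hs t ht h
  have h1 := cayley_sub_conj z hs
  rw [h, cayley_sub_conj z ht] at h1
  have hs' := one_sub_ne_zero_of_mem_ball hs
  have ht' := one_sub_ne_zero_of_mem_ball ht
  have hz : (z.im : ℂ) ≠ 0 := by exact_mod_cast z.im_ne_zero
  have hI := Complex.I_ne_zero
  field_simp at h1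
  linear_combination -h1

lemma image_cayley (z : ℍ) : cayley z '' ball 0 1 = {w : ℂ | 0 < w.im} := by
  ext w
  constructor
  · rintro ⟨s, hs, rfl⟩
    exact cayley_im_pos z hs
  · intro hw
    have hw' : 0 < w.im := hw
    have hz := z.im_pos
    have hne : w - conj (z : ℂ) ≠ 0 := by
      intro h
      have := congrArg Complex.im h
      simp at this
      linarith
    have hzc : (z : ℂ) - conj (z : ℂ) ≠ 0 := by
      rw [Complex.sub_conj]
      simpa using z.im_ne_zero
    refine ⟨(w - z) / (w - conj (z : ℂ)), ?_, ?_⟩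
    · rw [mem_ball_zero_iff, norm_div, div_lt_one (norm_pos_iff.mpr hne),
        ← sq_lt_sq₀ (norm_nonneg _) (norm_nonneg _), ← Complex.normSq_eq_norm_sq,
        ← Complex.normSq_eq_norm_sq]
      simp only [Complex.normSq_apply, Complex.sub_re, Complex.sub_im, Complex.conj_re,
        Complex.conj_im, coe_re, coe_im]
      nlinarith [mul_pos hz hw']
    · have h1 : 1 - (w - z) / (w - conj (z : ℂ)) = (z - conj (z : ℂ)) / (w - conj (z : ℂ)) := by
        field_simp
        ring
      rw [cayley, h1, div_eq_iff (div_ne_zero hzc hne)]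
      field_simp
      ring

lemma hasDerivAt_cayley (z : ℍ) {s : ℂ} (hs : s ∈ ball (0 : ℂ) 1) :
    HasDerivAt (cayley z) (2 * z.im * Complex.I / (1 - s) ^ 2) s := by
  have h := one_sub_ne_zero_of_mem_ball hs
  have h2 : (z : ℂ) - conj (z : ℂ) = 2 * z.im * Complex.I := by
    rw [Complex.sub_conj]
    simp
  have h3 : HasDerivAt (fun s : ℂ => (z : ℂ) - conj (z : ℂ) * s) (-conj (z : ℂ)) s := by
    simpa using ((hasDerivAt_id s).const_mul (conj (z : ℂ))).const_sub (z : ℂ)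
  have h4 : HasDerivAt (fun s : ℂ => 1 - s) (-1) s := by
    simpa using (hasDerivAt_id s).const_sub (1 : ℂ)
  refine (h3.fun_div h4 h).congr_deriv ?_
  rw [← h2]
  ring

/-- The real derivative of `cayley z`. -/
def cayleyFDeriv (z : ℍ) (s : ℂ) : ℂ →L[ℝ] ℂ :=
  (ContinuousLinearMap.toSpanSingleton ℂ (2 * z.im * Complex.I / (1 - s) ^ 2)).restrictScalars ℝ

lemma abs_det_cayleyFDeriv (z : ℍ) (s : ℂ) :
    |(cayleyFDeriv z s).det| = 4 * z.im ^ 2 / ‖1 - s‖ ^ 4 := by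
  simp [cayleyFDeriv, ContinuousLinearMap.det, LinearMap.det_restrictScalars,
    Algebra.norm_complex_eq, Complex.normSq_eq_norm_sq, abs_of_pos z.im_pos, -map_pow]
  rw [abs_of_nonneg (by positivity)]
  ring

lemma hasFDerivWithinAt_cayley (z : ℍ) {s : ℂ} (hs : s ∈ ball (0 : ℂ) 1) :
    HasFDerivWithinAt (cayley z) (cayleyFDeriv z s) (ball 0 1) s :=
  ((hasDerivAt_cayley z hs).hasFDerivAt.restrictScalars ℝ).hasFDerivWithinAt

/-- The function `(τ - z̄) ^ (-k)`. -/
def bergmanSeed (k : ℕ) (z τ : ℍ) : ℂ := (((τ : ℂ) - conj (z : ℂ)) ^ k)⁻¹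

/-- The pullback of a form of weight `k` to the unit disc. -/
def discPullback (k : ℕ) (z : ℍ) (f : ℍ → ℂ) (s : ℂ) : ℂ :=
  f (ofComplex (cayley z s)) * ((1 - s) ^ k)⁻¹

lemma differentiableOn_discPullback (k : ℕ) (z : ℍ) {f : ℍ → ℂ} (hf : MDiff f) :
    DifferentiableOn ℂ (discPullback k z f) (ball 0 1) := by
  refine DifferentiableOn.mul ?_ ?_
  · exact (UpperHalfPlane.mdifferentiable_iff.mp hf).comp
      (fun s hs => (hasDerivAt_cayley z hs).differentiableAt.differentiableWithinAt)
      (fun s hs => cayley_im_pos z hs)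
  · exact DifferentiableOn.inv (by fun_prop)
      fun s hs => pow_ne_zero _ (one_sub_ne_zero_of_mem_ball hs)

/-- The imaginary part of `cayley z s` is Im z (1 - |s|²) / |1 - s|², so boundedness of |f|² y ^ k
limits the growth of the pullback at the unit circle. -/
lemma discPullback_bound {k : ℕ} (hk : 4 ≤ k) (z : ℍ) {f : ℍ → ℂ} {M : ℝ}
    (hM : ∀ τ, ‖f τ‖ ^ 2 * τ.im ^ k ≤ M) {s : ℂ} (hs : s ∈ ball (0 : ℂ) 1) :
    ‖discPullback k z f s * ((1 - ‖s‖ ^ 2 : ℝ) : ℂ) ^ (k - 2)‖ ≤ √(M / z.im ^ k) := by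
  have h1 := norm_pos_iff.mpr (one_sub_ne_zero_of_mem_ball hs)
  have h2 := one_sub_norm_sq_pos hs
  have h3 : 1 - ‖s‖ ^ 2 ≤ 1 := by nlinarith [norm_nonneg s]
  have hz := z.im_pos
  refine Real.le_sqrt_of_sq_le ?_
  rw [le_div_iff₀ (by positivity)]
  refine le_trans ?_ (hM (ofComplex (cayley z s)))
  have him : (ofComplex (cayley z s)).im = z.im * (1 - ‖s‖ ^ 2) / ‖1 - s‖ ^ 2 := by
    rw [← cayley_im z hs, ofComplex_apply_of_im_pos (cayley_im_pos z hs)]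
    rfl
  rw [him, discPullback]
  simp only [norm_mul, norm_pow, norm_inv, Complex.norm_real, Real.norm_of_nonneg h2.le]
  generalize ‖f _‖ = F
  -- The weight has exponent k - 2 instead of k / 2. The inequality 2(k - 2) ≥ k is where k ≥ 4 is
  -- needed.
  have h4 : (1 - ‖s‖ ^ 2) ^ ((k - 2) * 2) ≤ (1 - ‖s‖ ^ 2) ^ k :=
    pow_le_pow_of_le_one h2.le h3 (by omega)
  calc (F * (‖1 - s‖ ^ k)⁻¹ * (1 - ‖s‖ ^ 2) ^ (k - 2)) ^ 2 * z.im ^ k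
      = F ^ 2 * (z.im ^ k * (1 - ‖s‖ ^ 2) ^ ((k - 2) * 2) / (‖1 - s‖ ^ 2) ^ k) := by
        rw [pow_mul (1 - ‖s‖ ^ 2), ← pow_mul ‖1 - s‖, mul_comm 2 k, pow_mul ‖1 - s‖]
        field_simp
    _ ≤ F ^ 2 * (z.im ^ k * (1 - ‖s‖ ^ 2) ^ k / (‖1 - s‖ ^ 2) ^ k) := by gcongr
    _ = _ := by rw [div_pow, mul_pow]

/-- The Jacobian and the power of the imaginary part together give |1 - s| ^ (-2k), and the
conjugated seed gives the k-th power of the conjugate of 1 - s. What is left is the holomorphic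
factor (1 - s) ^ (-k) of `discPullback` and a radial weight. -/
lemma cayley_integrand {k : ℕ} (hk : 2 ≤ k) (z : ℍ) (f : ℍ → ℂ) {s : ℂ}
    (hs : s ∈ ball (0 : ℂ) 1) :
    |(cayleyFDeriv z s).det| • (((1 / (cayley z s).im) ^ 2 : ℝ) •
        petersson k (bergmanSeed k z) f (ofComplex (cayley z s))) =
      4 * z.im ^ k * conj (((2 * z.im * Complex.I : ℂ) ^ k)⁻¹) *
        (discPullback k z f s * ((1 - ‖s‖ ^ 2 : ℝ) : ℂ) ^ (k - 2)) := by
  obtain ⟨m, rfl⟩ := Nat.exists_eq_add_of_le' hk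
  have hC := one_sub_ne_zero_of_mem_ball hs
  have hCb : conj (1 - s) ≠ 0 := (map_ne_zero _).mpr hC
  have hR : ((1 - ‖s‖ ^ 2 : ℝ) : ℂ) ≠ 0 := by exact_mod_cast (one_sub_norm_sq_pos hs).ne'
  have hy : (z.im : ℂ) ≠ 0 := by exact_mod_cast z.im_ne_zero
  have hI : (2 * z.im * Complex.I : ℂ) ≠ 0 := by simp [hy]
  have hIb : conj (2 * z.im * Complex.I : ℂ) ≠ 0 := by simpa using hy
  have hN : ((‖1 - s‖ : ℝ) : ℂ) ^ 2 = (1 - s) * conj (1 - s) := by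
    rw [Complex.mul_conj, Complex.normSq_eq_norm_sq]
    push_cast
    rfl
  have hcoe : ((ofComplex (cayley z s) : ℍ) : ℂ) = cayley z s := by
    rw [ofComplex_apply_of_im_pos (cayley_im_pos z hs)]
  have him : (ofComplex (cayley z s)).im = (cayley z s).im := by
    rw [← coe_im, hcoe]
  have himC : ((cayley z s).im : ℂ) =
      z.im * ((1 - ‖s‖ ^ 2 : ℝ) : ℂ) / ((1 - s) * conj (1 - s)) := by
    rw [cayley_im z hs, ← hN]
    push_cast
    rfl
  rw [abs_det_cayleyFDeriv, petersson, bergmanSeed, hcoe, cayley_sub_conj z hs, him, discPullback]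
  simp only [Complex.real_smul, zpow_natCast, Nat.add_sub_cancel]
  generalize f _ = F
  generalize ((1 - ‖s‖ ^ 2 : ℝ) : ℂ) = R at *
  push_cast
  rw [show ((‖1 - s‖ : ℝ) : ℂ) ^ 4 = (((‖1 - s‖ : ℝ) : ℂ) ^ 2) ^ 2 by ring, hN, himC]
  simp only [map_inv₀, map_pow, map_div₀]
  generalize conj (2 * z.im * Complex.I : ℂ) = J at *
  generalize hCC : conj (1 - s) = Cb at *
  generalize 1 - s = C at *
  rw [div_pow _ _ (m + 2), div_pow _ _ (m + 2), mul_pow _ _ (m + 2), mul_pow _ _ (m + 2)]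
  field_simp
  ring

/-- In the disc the integrand is a holomorphic function times (1 - |s|²) ^ (k - 2), so the integral
is a multiple of its value at the centre, which is f(z). -/
theorem integral_petersson_bergmanSeed {k : ℕ} (hk : 4 ≤ k) (z : ℍ) {f : ℍ → ℂ} (hf : MDiff f)
    {M : ℝ} (hM : ∀ τ, ‖f τ‖ ^ 2 * τ.im ^ k ≤ M) :
    ∫ τ, petersson k (bergmanSeed k z) f τ =
      4 * Real.pi / (k - 1) * z.im ^ k * conj (((2 * z.im * Complex.I : ℂ) ^ k)⁻¹) * f z := by
  rw [integral_eq_integral_im_pos, ← image_cayley z,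
    integral_image_eq_integral_abs_det_fderiv_smul volume measurableSet_ball
      (fun s hs => hasFDerivWithinAt_cayley z hs) (injOn_cayley z),
    setIntegral_congr_fun measurableSet_ball (fun s hs => cayley_integrand (by omega) z f hs),
    integral_const_mul, integral_ball_mul_weight (differentiableOn_discPullback k z hf) (k - 2)
      (fun s hs => discPullback_bound hk z hM hs)]
  have h0 : discPullback k z f 0 = f z := by simp [discPullback, cayley]
  rw [h0]
  push_cast [Nat.cast_sub (show 2 ≤ k by omega)]
  rw [show ((k : ℂ) - 2 + 1) = k - 1 by ring]
  ring

theorem integrable_petersson_bergmanSeed {k : ℕ} (hk : 4 ≤ k) (z : ℍ) {f : ℍ → ℂ} (hf : MDiff f)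
    {M : ℝ} (hM : ∀ τ, ‖f τ‖ ^ 2 * τ.im ^ k ≤ M) :
    Integrable (petersson k (bergmanSeed k z) f) := by
  rw [integrable_iff_integrableOn_im_pos, ← image_cayley z,
    integrableOn_image_iff_integrableOn_abs_det_fderiv_smul volume measurableSet_ball
      (fun s hs => hasFDerivWithinAt_cayley z hs) (injOn_cayley z),
    integrableOn_congr_fun (fun s hs => cayley_integrand (by omega) z f hs) measurableSet_ball]
  have h : IntegrableOn (fun s => discPullback k z f s * ((1 - ‖s‖ ^ 2 : ℝ) : ℂ) ^ (k - 2))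
      (ball 0 1) := by
    have hc : ContinuousOn (fun s => discPullback k z f s * ((1 - ‖s‖ ^ 2 : ℝ) : ℂ) ^ (k - 2))
        (ball 0 1) := (differentiableOn_discPullback k z hf).continuousOn.mul (by fun_prop)
    have : IsFiniteMeasure (volume.restrict (ball (0 : ℂ) 1)) :=
      ⟨by simp⟩
    exact Integrable.of_bound (hc.aestronglyMeasurable measurableSet_ball) √(M / z.im ^ k)
      ((ae_restrict_mem measurableSet_ball).mono fun s hs => discPullback_bound hk z hM hs)
  exact h.const_mul _

end ModularAverage

end

/-! ### Unfolding over the modular group -/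

noncomputable section

namespace ModularAverage

open UpperHalfPlane Set Metric

instance countable_SL2Z : Countable SL(2, ℤ) :=
  have : Countable (Matrix (Fin 2) (Fin 2) ℤ) := inferInstanceAs (Countable (Fin 2 → Fin 2 → ℤ))
  Subtype.countable

lemma measurableEmbedding_SL2Z_smul (γ : SL(2, ℤ)) :
    MeasurableEmbedding (fun τ : ℍ => γ • τ) :=
  measurableEmbedding_const_smul (γ : GL (Fin 2) ℝ)

lemma measurePreserving_SL2Z_smul (γ : SL(2, ℤ)) :
    MeasurePreserving (fun τ : ℍ => γ • τ) volume volume :=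
  measurePreserving_smul (γ : GL (Fin 2) ℝ) volume

lemma volume_re_eq (a : ℝ) : volume {w : ℂ | w.re = a} = 0 := by
  rw [← Complex.frontier_setOfPred_re_le]
  exact (convex_halfSpace_re_le a).addHaar_frontier volume

lemma volume_fd_diff_fdo : volume (𝒟 \ 𝒟ᵒ : Set ℍ) = 0 := by
  rw [volume_eq_lintegral]
  refine setLIntegral_measure_zero _ _ (measure_mono_null
    (t := {w : ℂ | w.re = 1 / 2} ∪ {w : ℂ | w.re = -(1 / 2)} ∪ sphere 0 1) ?_ ?_)
  · rintro _ ⟨τ, ⟨⟨h1, h2⟩, h3⟩, rfl⟩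
    by_contra h
    simp only [mem_union, mem_ofPred_eq, mem_sphere_zero_iff_norm, not_or, coe_re] at h
    obtain ⟨⟨h4, h5⟩, h6⟩ := h
    refine h3 ⟨lt_of_le_of_ne h1 fun h => h6 ?_, lt_of_le_of_ne h2 fun h => ?_⟩
    · rw [Complex.normSq_eq_norm_sq] at h
      exact (sq_eq_sq₀ (norm_nonneg _) zero_le_one).mp (by rw [← h]; norm_num)
    · rcases (abs_eq (by norm_num)).mp h with h | h
      · exact h4 h
      · exact h5 h
  · rw [measure_union_null_iff, measure_union_null_iff]
    exact ⟨⟨volume_re_eq _, volume_re_eq _⟩, Measure.addHaar_sphere _ _ _⟩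

/-- Outside the countably many translates of the null boundary of 𝒟, a point moved into 𝒟 lands in
𝒟ᵒ, and only ±1 keep such a point in 𝒟. -/
lemma ae_exists_smul_mem_fdo :
    ∀ᵐ τ : ℍ, ∃ γ : SL(2, ℤ), γ • τ ∈ 𝒟ᵒ ∧ ∀ γ' : SL(2, ℤ), γ' • τ ∈ 𝒟 → γ' = γ ∨ γ' = -γ := by
  have h : ∀ᵐ τ : ℍ, ∀ γ : SL(2, ℤ), γ • τ ∉ (𝒟 \ 𝒟ᵒ : Set ℍ) := by
    rw [ae_all_iff]
    intro γ
    have h0 : ∀ᵐ τ : ℍ, τ ∉ (𝒟 \ 𝒟ᵒ : Set ℍ) :=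
      measure_eq_zero_iff_ae_notMem.mp volume_fd_diff_fdo
    exact (measurePreserving_SL2Z_smul γ).quasiMeasurePreserving.ae
      (p := fun τ => τ ∉ (𝒟 \ 𝒟ᵒ : Set ℍ)) h0
  refine h.mono fun τ hτ => ?_
  obtain ⟨γ, hγ⟩ := ModularGroup.exists_smul_mem_fd τ
  have hγo : γ • τ ∈ 𝒟ᵒ := by
    by_contra hn
    exact hτ γ ⟨hγ, hn⟩
  refine ⟨γ, hγo, fun γ' hγ' => ?_⟩
  have h2 : (γ' * γ⁻¹) • (γ • τ) ∈ 𝒟 := by rwa [smul_smul, inv_mul_cancel_right]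
  rcases ModularGroup.eq_one_or_neg_one_of_mem_fdo_mem_fd hγo h2 with h3 | h3
  · exact .inl (by rw [mul_inv_eq_one] at h3; exact h3)
  · refine .inr ?_
    rw [mul_inv_eq_iff_eq_mul] at h3
    rw [h3, neg_mul, one_mul]

lemma tsum_indicator_fd :
    ∀ᵐ τ : ℍ, ∑' γ : SL(2, ℤ), (𝒟 : Set ℍ).indicator (fun _ => (1 : ℝ≥0∞)) (γ⁻¹ • τ) = 2 := by
  refine ae_exists_smul_mem_fdo.mono fun τ ⟨γ, hγ, huniq⟩ => ?_
  rw [← (Equiv.inv SL(2, ℤ)).tsum_eq]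
  simp only [Equiv.inv_apply, inv_inv]
  have hne : γ ≠ -γ := by
    intro h
    have h1 := congrArg (fun g : SL(2, ℤ) => g.val) h
    have h2 : ∀ i j, γ.val i j = 0 := by
      intro i j
      have := congrFun (congrFun h1 i) j
      simp only [Matrix.SpecialLinearGroup.coe_neg, Matrix.neg_apply] at this
      omega
    have h3 := γ.det_coe
    rw [Matrix.det_fin_two] at h3
    simp [h2] at h3
  rw [tsum_eq_sum (s := {γ, -γ}) ?_, Finset.sum_pair hne, ModularGroup.SL_neg_smul,
    indicator_of_mem (ModularGroup.fdo_subset_fd hγ)]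
  · norm_num
  · intro γ' hγ'
    rw [indicator_of_notMem]
    intro h
    simp only [Finset.mem_insert, Finset.mem_singleton] at hγ'
    exact hγ' (huniq γ' h)

/-- The translates of the fundamental domain cover the upper half-plane twice. -/
theorem sum_map_smul_restrict_fd :
    Measure.sum (fun γ : SL(2, ℤ) => ((volume : Measure ℍ).restrict 𝒟).map (γ • ·)) =
      (2 : ℝ≥0∞) • volume := by
  have hD : MeasurableSet (𝒟 : Set ℍ) := ModularGroup.isClosed_fd.measurableSet
  refine Measure.ext_of_lintegral _ fun G hG => ?_
  rw [lintegral_sum_measure, lintegral_smul_measure]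
  have h : ∀ γ : SL(2, ℤ), ∫⁻ τ, G τ ∂(((volume : Measure ℍ).restrict 𝒟).map (γ • ·)) =
      ∫⁻ τ, (𝒟 : Set ℍ).indicator (fun _ => (1 : ℝ≥0∞)) (γ⁻¹ • τ) * G τ := by
    intro γ
    rw [(measurableEmbedding_SL2Z_smul γ).lintegral_map, ← lintegral_indicator hD,
      ← (measurePreserving_SL2Z_smul γ).lintegral_comp_emb (measurableEmbedding_SL2Z_smul γ)
        (fun τ => (𝒟 : Set ℍ).indicator (fun _ => (1 : ℝ≥0∞)) (γ⁻¹ • τ) * G τ)]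
    refine lintegral_congr fun τ => ?_
    rw [inv_smul_smul]
    by_cases hτ : τ ∈ (𝒟 : Set ℍ) <;> simp [hτ]
  simp_rw [h]
  rw [← lintegral_tsum]
  · rw [smul_eq_mul, ← lintegral_const_mul _ hG]
    refine lintegral_congr_ae (tsum_indicator_fd.mono fun τ hτ => ?_)
    simp only
    rw [ENNReal.tsum_mul_right, hτ]
  · intro γ
    exact (((measurable_const.indicator hD).comp
      (measurableEmbedding_SL2Z_smul γ⁻¹).measurable).mul hG).aemeasurable

lemma integrable_smul_of_integrable {E : Type*} [NormedAddCommGroup E] {F : ℍ → E}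
    (hF : Integrable F) (γ : SL(2, ℤ)) : Integrable fun τ => F (γ • τ) :=
  ((measurePreserving_SL2Z_smul γ).integrable_comp_emb (measurableEmbedding_SL2Z_smul γ)).mpr hF

lemma hasSum_integral_fd {E : Type*} [NormedAddCommGroup E] [NormedSpace ℝ E] {F : ℍ → E}
    (hF : Integrable F) :
    HasSum (fun γ : SL(2, ℤ) => ∫ τ in 𝒟, F (γ • τ)) ((2 : ℝ) • ∫ τ, F τ) := by
  have h : Integrable F (Measure.sum
      (fun γ : SL(2, ℤ) => ((volume : Measure ℍ).restrict 𝒟).map (γ • ·))) := by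
    rw [sum_map_smul_restrict_fd]
    exact hF.smul_measure (by simp)
  have h2 := hasSum_integral_measure h
  rw [sum_map_smul_restrict_fd, integral_smul_measure] at h2
  simp_rw [(measurableEmbedding_SL2Z_smul _).integral_map] at h2
  simpa using h2

/-- The unfolding of a sum over the modular group. -/
theorem integral_fd_tsum {F : ℍ → ℂ} (hF : Integrable F) :
    ∫ τ in 𝒟, ∑' γ : SL(2, ℤ), F (γ • τ) = 2 * ∫ τ, F τ := by
  have h1 := hasSum_integral_of_summable_integral_norm
    (fun γ => (integrable_smul_of_integrable hF γ).restrict (s := 𝒟))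
    (hasSum_integral_fd hF.norm).summable
  rw [← h1.tsum_eq, (hasSum_integral_fd hF).tsum_eq]
  simp

end ModularAverage

end

/-! ### The Poincaré series attached to a point -/

noncomputable section

namespace ModularAverage

open UpperHalfPlane Set
open scoped ComplexConjugate Manifold ModularForm

/-- The coefficient of `τ` in `pairing z γ τ`. -/
def pairingSlope (z : ℍ) (γ : SL(2, ℤ)) : ℂ := γ 0 0 - conj (z : ℂ) * γ 1 0

/-- The constant coefficient of `pairing z γ τ`. -/
def pairingConst (z : ℍ) (γ : SL(2, ℤ)) : ℂ := γ 0 1 - conj (z : ℂ) * γ 1 1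

/-- The affine function `(a τ + b) - z̄ (c τ + d)` of `τ`. -/
def pairing (z : ℍ) (γ : SL(2, ℤ)) (τ : ℂ) : ℂ := pairingSlope z γ * τ + pairingConst z γ

lemma bergmanSeed_slash (k : ℕ) (z : ℍ) (γ : SL(2, ℤ)) (τ : ℍ) :
    (bergmanSeed k z ∣[(k : ℤ)] γ) τ = (pairing z γ τ ^ k)⁻¹ := by
  have hd : (γ 1 0 : ℂ) * τ + γ 1 1 ≠ 0 := by
    rw [← ModularGroup.denom_apply]
    exact denom_ne_zero _ τ
  rw [ModularForm.SL_slash_apply, ModularGroup.denom_apply, bergmanSeed,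
    coe_specialLinearGroup_apply, zpow_neg, zpow_natCast, ← mul_inv, ← mul_pow]
  simp only [algebraMap_int_eq, eq_intCast, Complex.ofReal_intCast]
  rw [sub_mul, div_mul_cancel₀ _ hd, pairing, pairingSlope, pairingConst]
  congr 2
  ring

lemma det_eq_one (γ : SL(2, ℤ)) : γ 0 0 * γ 1 1 - γ 0 1 * γ 1 0 = 1 := by
  have h := γ.det_coe
  rwa [Matrix.det_fin_two] at h

/-- Because the determinant is 1, the product of the pairing with the conjugate slope has imaginary
part |slope|² Im τ + Im z. -/
lemma norm_pairingSlope_mul_im_le (z τ : ℍ) (γ : SL(2, ℤ)) :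
    ‖pairingSlope z γ‖ * τ.im ≤ ‖pairing z γ τ‖ := by
  rcases eq_or_ne (pairingSlope z γ) 0 with h | h
  · simp [h]
  have hdet : (γ 0 0 * γ 1 1 - γ 0 1 * γ 1 0 : ℝ) = 1 := by exact_mod_cast det_eq_one γ
  have him : (pairing z γ τ * conj (pairingSlope z γ)).im =
      ‖pairingSlope z γ‖ ^ 2 * τ.im + z.im := by
    rw [← Complex.normSq_eq_norm_sq]
    simp [pairing, pairingSlope, pairingConst, Complex.normSq_apply]
    linear_combination z.im * hdet
  have h1 : ‖pairingSlope z γ‖ ^ 2 * τ.im ≤ ‖pairing z γ τ‖ * ‖pairingSlope z γ‖ := by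
    calc ‖pairingSlope z γ‖ ^ 2 * τ.im ≤ (pairing z γ τ * conj (pairingSlope z γ)).im := by
          rw [him]; linarith [z.im_pos]
      _ ≤ ‖pairing z γ τ * conj (pairingSlope z γ)‖ := (le_abs_self _).trans (Complex.abs_im_le_norm _)
      _ = _ := by rw [norm_mul, Complex.norm_conj]
  have h2 := norm_pos_iff.mpr h
  nlinarith

/-- The slope involves only the first column of γ and the constant only the second. The product
bound therefore reduces convergence over the group to two independent sums over ℤ². -/
lemma norm_slope_mul_norm_const_le (z τ : ℍ) (γ : SL(2, ℤ)) :
    ‖pairingSlope z γ‖ * ‖pairingConst z γ‖ * τ.im ^ 2 ≤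
      ‖pairing z γ τ‖ ^ 2 * (τ.im + ‖(τ : ℂ)‖) := by
  have h1 := norm_pairingSlope_mul_im_le z τ γ
  have h2 : ‖pairingConst z γ‖ ≤ ‖pairing z γ τ‖ + ‖pairingSlope z γ‖ * ‖(τ : ℂ)‖ := by
    rw [← norm_mul]
    have : pairingConst z γ = pairing z γ τ - pairingSlope z γ * τ := by rw [pairing]; ring
    rw [this]
    exact norm_sub_le _ _
  have hv := τ.im_pos
  calc ‖pairingSlope z γ‖ * ‖pairingConst z γ‖ * τ.im ^ 2
      = (‖pairingSlope z γ‖ * τ.im) * (‖pairingConst z γ‖ * τ.im) := by ring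
    _ ≤ ‖pairing z γ τ‖ * ((‖pairing z γ τ‖ + ‖pairingSlope z γ‖ * ‖(τ : ℂ)‖) * τ.im) := by gcongr
    _ = ‖pairing z γ τ‖ * (‖pairing z γ τ‖ * τ.im + (‖pairingSlope z γ‖ * τ.im) * ‖(τ : ℂ)‖) := by
        ring
    _ ≤ ‖pairing z γ τ‖ * (‖pairing z γ τ‖ * τ.im + ‖pairing z γ τ‖ * ‖(τ : ℂ)‖) := by gcongr
    _ = _ := by ring

lemma norm_pairingSlope_eq (z : ℍ) (γ : SL(2, ℤ)) :
    ‖pairingSlope z γ‖ = ‖((-γ 1 0 : ℤ) : ℂ) * z + γ 0 0‖ := by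
  rw [← Complex.norm_conj, pairingSlope]
  congr 1
  simp
  ring

lemma norm_pairingConst_eq (z : ℍ) (γ : SL(2, ℤ)) :
    ‖pairingConst z γ‖ = ‖((-γ 1 1 : ℤ) : ℂ) * z + γ 0 1‖ := by
  rw [← Complex.norm_conj, pairingConst]
  congr 1
  simp
  ring

lemma pairingSlope_ne_zero (z : ℍ) (γ : SL(2, ℤ)) : pairingSlope z γ ≠ 0 := by
  intro h
  have h1 := congrArg Complex.im h
  have h2 := congrArg Complex.re h
  simp [pairingSlope, z.im_ne_zero] at h1
  simp [pairingSlope, h1] at h2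
  have := det_eq_one γ
  simp [h1, h2] at this

lemma pairingConst_ne_zero (z : ℍ) (γ : SL(2, ℤ)) : pairingConst z γ ≠ 0 := by
  intro h
  have h1 := congrArg Complex.im h
  have h2 := congrArg Complex.re h
  simp [pairingConst, z.im_ne_zero] at h1
  simp [pairingConst, h1] at h2
  have := det_eq_one γ
  simp [h1, h2] at this

lemma pairing_ne_zero (z τ : ℍ) (γ : SL(2, ℤ)) : pairing z γ τ ≠ 0 := by
  have h := norm_pairingSlope_mul_im_le z τ γ
  have := mul_pos (norm_pos_iff.mpr (pairingSlope_ne_zero z γ)) τ.im_pos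
  exact norm_pos_iff.mp (this.trans_le h)

/-- A summable majorant of the terms of the Poincaré series, up to a factor depending on `τ`. -/
def majorant (m : ℕ) (z : ℍ) (γ : SL(2, ℤ)) : ℝ :=
  (‖pairingSlope z γ‖ ^ m)⁻¹ * (‖pairingConst z γ‖ ^ m)⁻¹

/-- A matrix is determined by its columns, so the series is part of a product of two absolutely
convergent Eisenstein series of weight m. -/
lemma summable_majorant {m : ℕ} (hm : 3 ≤ m) (z : ℍ) : Summable (majorant m z) := by
  have h := EisensteinSeries.summable_norm_eisSummand (k := m) (by exact_mod_cast hm) z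
  have h2 := h.mul_of_nonneg h (fun _ => norm_nonneg _) (fun _ => norm_nonneg _)
  have hinj : Function.Injective (fun γ : SL(2, ℤ) =>
      ((![-γ 1 0, γ 0 0] : Fin 2 → ℤ), (![-γ 1 1, γ 0 1] : Fin 2 → ℤ))) := by
    intro γ γ' h
    simp only [Prod.mk.injEq] at h
    have h1 := congrFun h.1 0
    have h2 := congrFun h.1 1
    have h3 := congrFun h.2 0
    have h4 := congrFun h.2 1
    simp at h1 h2 h3 h4
    ext i j
    fin_cases i <;> fin_cases j <;> simp [h1, h2, h3, h4]
  refine (h2.comp_injective hinj).congr fun γ => ?_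
  simp [majorant, norm_pairingSlope_eq, norm_pairingConst_eq, EisensteinSeries.eisSummand]

lemma norm_term_le (m : ℕ) (z τ : ℍ) (γ : SL(2, ℤ)) :
    ‖(pairing z γ τ ^ (2 * m))⁻¹‖ ≤
      ((τ.im + ‖(τ : ℂ)‖) / τ.im ^ 2) ^ m * majorant m z γ := by
  have h := norm_slope_mul_norm_const_le z τ γ
  have h1 := norm_pos_iff.mpr (pairingSlope_ne_zero z γ)
  have h2 := norm_pos_iff.mpr (pairingConst_ne_zero z γ)
  have h3 := norm_pos_iff.mpr (pairing_ne_zero z τ γ)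
  have hv := τ.im_pos
  have h4 : (‖pairing z γ τ‖ ^ 2)⁻¹ ≤
      (τ.im + ‖(τ : ℂ)‖) / τ.im ^ 2 * (‖pairingSlope z γ‖ * ‖pairingConst z γ‖)⁻¹ := by
    rw [inv_le_iff_one_le_mul₀ (by positivity), div_mul_eq_mul_div, div_mul_eq_mul_div,
      one_le_div (by positivity), mul_inv]
    field_simp
    linarith
  rw [norm_inv, norm_pow, pow_mul, majorant, ← mul_inv, ← mul_pow]
  have h5 := pow_le_pow_left₀ (by positivity) h4 m
  rwa [inv_pow, mul_pow, inv_pow] at h5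

/-- The sum of the translates of `bergmanSeed k z` over the modular group. -/
def poincareSeries (k : ℕ) (z τ : ℍ) : ℂ := ∑' γ : SL(2, ℤ), (bergmanSeed k z ∣[(k : ℤ)] γ) τ

lemma poincareSeries_eq (k : ℕ) (z τ : ℍ) :
    poincareSeries k z τ = ∑' γ : SL(2, ℤ), (pairing z γ τ ^ k)⁻¹ := by
  simp_rw [poincareSeries, bergmanSeed_slash]

lemma summable_pairing {m : ℕ} (hm : 3 ≤ m) (z τ : ℍ) :
    Summable fun γ : SL(2, ℤ) => (pairing z γ τ ^ (2 * m))⁻¹ :=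
  .of_norm_bounded ((summable_majorant hm z).mul_left _) (norm_term_le m z τ)

lemma poincareSeries_slash (k : ℕ) (z : ℍ) (γ : SL(2, ℤ)) :
    poincareSeries k z ∣[(k : ℤ)] γ = poincareSeries k z := by
  ext τ
  rw [ModularForm.SL_slash_apply, poincareSeries, poincareSeries, ← tsum_mul_right]
  conv_rhs => rw [← (Equiv.mulRight γ).tsum_eq]
  refine tsum_congr fun γ' => ?_
  rw [Equiv.coe_mulRight, SlashAction.slash_mul, ModularForm.SL_slash_apply (_ ∣[(k : ℤ)] γ')]

lemma mdifferentiable_poincareSeries {m : ℕ} (hm : 3 ≤ m) (z : ℍ) :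
    MDiff (poincareSeries (2 * m) z) := by
  rw [UpperHalfPlane.mdifferentiable_iff]
  have h1 : DifferentiableOn ℂ (fun w : ℂ => ∑' γ : SL(2, ℤ), (pairing z γ w ^ (2 * m))⁻¹)
      {w | 0 < w.im} := by
    intro w₀ hw₀
    replace hw₀ : 0 < w₀.im := hw₀
    -- On `U` the imaginary part is bounded below and the norm above, which makes the factor in
    -- `norm_term_le` uniform.
    set U : Set ℂ := {w | w₀.im / 2 < w.im} ∩ {w | w.im + ‖w‖ < w₀.im + ‖w₀‖ + 1} with hU
    have hUo : IsOpen U := (isOpen_lt (by fun_prop) (by fun_prop)).inter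
      (isOpen_lt (by fun_prop) (by fun_prop))
    have hmem : w₀ ∈ U := ⟨by simp only [mem_ofPred_eq]; linarith, by simp⟩
    refine (DifferentiableOn.differentiableAt ?_ (hUo.mem_nhds hmem)).differentiableWithinAt
    refine Complex.differentiableOn_tsum_of_summable_norm
      ((summable_majorant hm z).mul_left
        (((w₀.im + ‖w₀‖ + 1) / (w₀.im / 2) ^ 2) ^ m)) (fun γ => ?_) hUo (fun γ w hw => ?_)
    · refine DifferentiableOn.inv ?_ fun w hw => pow_ne_zero _ ?_
      · unfold pairing
        fun_prop
      · exact pairing_ne_zero z ⟨w, lt_trans (by linarith) hw.1⟩ γ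
    · obtain ⟨hw1, hw2⟩ := hw
      simp only [mem_ofPred_eq] at hw1 hw2
      refine (norm_term_le m z ⟨w, lt_trans (by linarith) hw1⟩ γ).trans ?_
      have h0 : 0 ≤ majorant m z γ := by unfold majorant; positivity
      have hwp : 0 < w.im := by linarith
      have hnn := norm_nonneg w
      change ((w.im + ‖w‖) / w.im ^ 2) ^ m * _ ≤ _
      gcongr
  refine h1.congr fun w hw => ?_
  simp only [Function.comp, poincareSeries_eq, ofComplex_apply_of_im_pos hw]

/-- `poincareSeries` as a slash invariant form. -/
def poincareSIF (k : ℕ) (z : ℍ) : SlashInvariantForm 𝒮ℒ (k : ℤ) where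
  toFun := poincareSeries k z
  slash_action_eq' := by
    rintro _ ⟨γ, rfl⟩
    exact poincareSeries_slash k z γ

lemma poincareSeries_isZeroAtImInfty {m : ℕ} (hm : 3 ≤ m) (z : ℍ) :
    IsZeroAtImInfty (poincareSeries (2 * m) z) := by
  rw [isZeroAtImInfty_iff]
  intro ε hε
  set S := ∑' γ, majorant m z γ with hS
  have hS0 : 0 ≤ S := tsum_nonneg fun γ => by unfold majorant; positivity
  -- The first bound makes 3 / Im τ ≤ 1, so its m-th power is at most itself. The second makes 3S /
  -- Im τ ≤ ε.
  refine ⟨max 3 (3 * S / ε), fun τ₀ hτ₀ => ?_⟩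
  -- The factor in `norm_term_le` grows with the real part, so periodicity is used to move the point
  -- near the imaginary axis.
  set n : ℤ := -round τ₀.re with hn
  set τ : ℍ := (n : ℝ) +ᵥ τ₀ with hτ
  have hper : poincareSeries (2 * m) z τ₀ = poincareSeries (2 * m) z τ :=
    (SlashInvariantForm.vAdd_apply_of_mem_strictPeriods (poincareSIF (2 * m) z) τ₀
      (by rw [Subgroup.strictPeriods_SL2Z, AddSubgroup.mem_zmultiples_iff]; exact ⟨n, by simp⟩)).symm
  have him : τ.im = τ₀.im := by simp [hτ]
  have hre : |τ.re| ≤ 1 := by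
    have h1 := abs_sub_round τ₀.re
    have h2 : τ.re = τ₀.re - round τ₀.re := by simp [hτ, hn]; ring
    rw [h2]
    linarith
  have h3 : 3 ≤ τ.im := by rw [him]; exact (le_max_left _ _).trans hτ₀
  have h4 : 3 * S / ε ≤ τ.im := by rw [him]; exact (le_max_right _ _).trans hτ₀
  have hnorm : ‖(τ : ℂ)‖ ≤ 1 + τ.im := by
    refine (Complex.norm_le_abs_re_add_abs_im _).trans ?_
    simp only [coe_re, coe_im, abs_of_pos τ.im_pos]
    linarith
  have hq : (τ.im + ‖(τ : ℂ)‖) / τ.im ^ 2 ≤ 3 / τ.im := by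
    rw [div_le_div_iff₀ (by positivity) (by positivity)]
    nlinarith
  have hq1 : 3 / τ.im ≤ 1 := (div_le_one (by positivity)).mpr h3
  have hqm : ((τ.im + ‖(τ : ℂ)‖) / τ.im ^ 2) ^ m ≤ 3 / τ.im :=
    calc _ ≤ (3 / τ.im) ^ m := by gcongr
      _ ≤ (3 / τ.im) ^ 1 := pow_le_pow_of_le_one (by positivity) hq1 (by omega)
      _ = _ := pow_one _
  rw [hper, poincareSeries_eq]
  calc ‖∑' γ : SL(2, ℤ), (pairing z γ τ ^ (2 * m))⁻¹‖
      ≤ ∑' γ, ((τ.im + ‖(τ : ℂ)‖) / τ.im ^ 2) ^ m * majorant m z γ :=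
        tsum_of_norm_bounded ((summable_majorant hm z).mul_left _).hasSum (norm_term_le m z τ)
    _ = ((τ.im + ‖(τ : ℂ)‖) / τ.im ^ 2) ^ m * S := tsum_mul_left
    _ ≤ 3 / τ.im * S := by gcongr
    _ = 3 * S / τ.im := by ring
    _ ≤ ε := by
        rw [div_le_iff₀ hε] at h4
        rw [div_le_iff₀ (by positivity)]
        linarith

/-- The Poincaré series as a cusp form. -/
def poincareCuspForm {m : ℕ} (hm : 3 ≤ m) (z : ℍ) : CuspForm 𝒮ℒ ((2 * m : ℕ) : ℤ) where
  toSlashInvariantForm := poincareSIF (2 * m) z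
  holo' := mdifferentiable_poincareSeries hm z
  zero_at_cusps' hc := by
    rw [OnePoint.isZeroAt_iff_forall_SL2Z hc]
    intro γ _
    change IsZeroAtImInfty (poincareSeries (2 * m) z ∣[((2 * m : ℕ) : ℤ)] γ)
    rw [poincareSeries_slash]
    exact poincareSeries_isZeroAtImInfty hm z

end ModularAverage

end

/-! ### The Bergman kernel of the space of cusp forms -/

noncomputable section

namespace ModularAverage

open UpperHalfPlane Set
open scoped ComplexConjugate Manifold ModularForm

lemma exists_cuspForm_bound {k : ℕ} (f : CuspForm 𝒮ℒ (k : ℤ)) :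
    ∃ M : ℝ, ∀ τ, ‖f τ‖ ^ 2 * τ.im ^ k ≤ M := by
  obtain ⟨M, hM⟩ := CuspFormClass.petersson_bounded_left k 𝒮ℒ f f
  refine ⟨M, fun τ => le_trans (le_of_eq ?_) (hM τ)⟩
  simp [petersson, abs_of_pos τ.im_pos, sq]

/-- The reproducing property of the Poincaré series. -/
theorem peterssonInner_poincareCuspForm {m : ℕ} (hm : 3 ≤ m) (z : ℍ)
    (f : CuspForm 𝒮ℒ ((2 * m : ℕ) : ℤ)) :
    peterssonInner f (poincareCuspForm hm z) =
      8 * Real.pi / ((2 * m : ℕ) - 1) * z.im ^ (2 * m) *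
        conj (((2 * z.im * Complex.I : ℂ) ^ (2 * m))⁻¹) * f z := by
  obtain ⟨M, hM⟩ := exists_cuspForm_bound f
  have hk : 4 ≤ 2 * m := by omega
  have hmd : MDiff (f : ℍ → ℂ) := f.holo'
  have hf : ∀ γ : SL(2, ℤ), (f : ℍ → ℂ) ∣[((2 * m : ℕ) : ℤ)] γ = f := fun γ =>
    f.slash_action_eq' _ ⟨γ, rfl⟩
  have h1 : ∀ τ, petersson (2 * m : ℕ) (poincareCuspForm hm z) f τ =
      ∑' γ : SL(2, ℤ), petersson (2 * m : ℕ) (bergmanSeed (2 * m) z) f (γ • τ) := by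
    intro τ
    -- Invariance of f puts the whole action of γ on the seed, so the sum over γ produces the
    -- Poincaré series.
    have h2 : ∀ γ : SL(2, ℤ), petersson (2 * m : ℕ) (bergmanSeed (2 * m) z) f (γ • τ) =
        conj ((bergmanSeed (2 * m) z ∣[((2 * m : ℕ) : ℤ)] γ) τ) *
          (f τ * τ.im ^ ((2 * m : ℕ) : ℤ)) := by
      intro γ
      rw [← petersson_slash_SL, hf, petersson, mul_assoc]
    simp_rw [h2]
    rw [tsum_mul_right, ← Complex.conj_tsum, petersson, mul_assoc]
    rfl
  rw [peterssonInner]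
  simp_rw [h1]
  rw [integral_fd_tsum (integrable_petersson_bergmanSeed hk z hmd hM),
    integral_petersson_bergmanSeed hk z hmd hM]
  push_cast
  ring

section Orthonormal

variable {k : ℤ} {B : Finset (CuspForm 𝒮ℒ k)}

lemma continuous_cuspForm (f : CuspForm 𝒮ℒ k) : Continuous (f : ℍ → ℂ) :=
  MDifferentiable.continuous f.holo'

/-- A non-integrable function has integral 0 by convention, which contradicts norm 1. -/
lemma IsOrthonormalBasis.integrableOn_self (hB : IsOrthonormalBasis B) {f : CuspForm 𝒮ℒ k}
    (hf : f ∈ B) : IntegrableOn (petersson k f f) 𝒟 := by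
  by_contra h
  have := hB.norm_one f hf
  rw [peterssonInner, integral_undef h] at this
  exact zero_ne_one this

lemma IsOrthonormalBasis.integrableOn (hB : IsOrthonormalBasis B) {f g : CuspForm 𝒮ℒ k}
    (hf : f ∈ B) (hg : g ∈ B) : IntegrableOn (petersson k g f) 𝒟 := by
  refine Integrable.mono' ((hB.integrableOn_self hf).norm.add (hB.integrableOn_self hg).norm)
    ?_ (.of_forall fun τ => ?_)
  · exact (petersson_continuous k (continuous_cuspForm g)
      (continuous_cuspForm f)).aestronglyMeasurable
  · simp only [petersson, norm_mul, Complex.norm_conj, Pi.add_apply]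
    have h := norm_nonneg ((τ.im : ℂ) ^ k)
    have h2 : ‖g τ‖ * ‖f τ‖ ≤ ‖f τ‖ * ‖f τ‖ + ‖g τ‖ * ‖g τ‖ := by
      nlinarith [sq_nonneg (‖g τ‖ - ‖f τ‖), sq_nonneg (‖g τ‖ + ‖f τ‖)]
    calc _ ≤ (‖f τ‖ * ‖f τ‖ + ‖g τ‖ * ‖g τ‖) * ‖(τ.im : ℂ) ^ k‖ := by gcongr
      _ = _ := by ring

lemma sum_smul_apply (s : Finset (CuspForm 𝒮ℒ k)) (a : CuspForm 𝒮ℒ k → ℂ) (τ : ℍ) :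
    (∑ g ∈ s, a g • g) τ = ∑ g ∈ s, a g * g τ := by
  classical
  induction s using Finset.induction_on with
  | empty => simp
  | insert b s hb ih =>
    rw [Finset.sum_insert hb, Finset.sum_insert hb, add_apply, ih]
    rfl

lemma IsOrthonormalBasis.peterssonInner_sum (hB : IsOrthonormalBasis B)
    (a : CuspForm 𝒮ℒ k → ℂ) {f : CuspForm 𝒮ℒ k} (hf : f ∈ B) :
    peterssonInner f (∑ g ∈ B, a g • g) = conj (a f) := by
  have h1 : petersson k (∑ g ∈ B, a g • g : CuspForm 𝒮ℒ k) f =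
      fun τ => ∑ g ∈ B, conj (a g) * petersson k g f τ := by
    ext τ
    rw [petersson, sum_smul_apply, map_sum, Finset.sum_mul, Finset.sum_mul]
    refine Finset.sum_congr rfl fun g _ => ?_
    rw [petersson, map_mul]
    ring
  rw [peterssonInner, h1, integral_finsetSum _ fun g hg => (hB.integrableOn hf hg).const_mul _,
    Finset.sum_eq_single_of_mem f hf]
  · rw [integral_const_mul]
    change _ * peterssonInner f f = _
    rw [hB.norm_one f hf, mul_one]
  · intro g hg hgf
    rw [integral_const_mul]
    change _ * peterssonInner f g = _
    rw [hB.orthogonal f hf g hg hgf.symm, mul_zero]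

lemma IsOrthonormalBasis.sum_peterssonInner_mul (hB : IsOrthonormalBasis B)
    (P : CuspForm 𝒮ℒ k) (z : ℍ) : P z = ∑ f ∈ B, conj (peterssonInner f P) * f z := by
  have hP : P ∈ Submodule.span ℂ (B : Set (CuspForm 𝒮ℒ k)) := by
    rw [hB.span_eq_top]; trivial
  obtain ⟨a, -, rfl⟩ := Submodule.mem_span_finset.mp hP
  rw [sum_smul_apply]
  refine Finset.sum_congr rfl fun f hf => ?_
  rw [hB.peterssonInner_sum a hf, Complex.conj_conj]

/-- Orthonormality gives linear independence. This ties the normalising factor |B| to the dimension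
formula. -/
lemma IsOrthonormalBasis.finrank_eq_card (hB : IsOrthonormalBasis B) :
    Module.finrank ℂ (CuspForm 𝒮ℒ k) = B.card := by
  have hli : LinearIndependent ℂ (Subtype.val : B → CuspForm 𝒮ℒ k) := by
    classical
    rw [Fintype.linearIndependent_iff]
    intro a ha f
    set a' : CuspForm 𝒮ℒ k → ℂ := fun g => if h : g ∈ B then a ⟨g, h⟩ else 0 with ha'
    have h1 : ∑ g ∈ B, a' g • g = 0 := by
      rw [← Finset.sum_attach, ← ha]
      exact Finset.sum_congr rfl fun g _ => by simp [ha']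
    have h2 := hB.peterssonInner_sum a' f.2
    rw [h1] at h2
    have h3 : peterssonInner f.1 (0 : CuspForm 𝒮ℒ k) = 0 := by
      simp [peterssonInner, petersson]
    rw [h3] at h2
    simpa [ha'] using h2.symm
  have h := finrank_span_finset_eq_card hli
  rwa [hB.span_eq_top, finrank_top] at h

end Orthonormal

/-- The Bergman kernel on the diagonal as a sum over the modular group. -/
theorem bergman_kernel_eq {m : ℕ} (hm : 3 ≤ m) {B : Finset (CuspForm 𝒮ℒ ((2 * m : ℕ) : ℤ))}
    (hB : IsOrthonormalBasis B) (z : ℍ) :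
    ((∑ f ∈ B, z.im ^ (2 * m) * ‖f z‖ ^ 2 : ℝ) : ℂ) =
      ((2 * m : ℕ) - 1) / (8 * Real.pi) *
        ∑' γ : SL(2, ℤ), ((pairing z γ z / (2 * z.im * Complex.I)) ^ (2 * m))⁻¹ := by
  -- The Poincaré series at z is expanded in the basis and evaluated at the same z, so each
  -- coefficient, a multiple of the conjugate of f(z), meets f(z).
  have h1 := hB.sum_peterssonInner_mul (poincareCuspForm hm z) z
  simp_rw [peterssonInner_poincareCuspForm] at h1
  have h2 : poincareCuspForm hm z z = ∑' γ : SL(2, ℤ), (pairing z γ z ^ (2 * m))⁻¹ :=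
    poincareSeries_eq (2 * m) z z
  have hI : (2 * z.im * Complex.I : ℂ) ≠ 0 := by simp [z.im_ne_zero]
  have hm1 : (((2 * m : ℕ) : ℂ) - 1) ≠ 0 := by
    rw [sub_ne_zero]
    exact_mod_cast (by omega : 2 * m ≠ 1)
  have hpi : (Real.pi : ℂ) ≠ 0 := by exact_mod_cast Real.pi_ne_zero
  have h3 : ∑ f ∈ B, conj (8 * Real.pi / ((2 * m : ℕ) - 1) * (z.im : ℂ) ^ (2 * m) *
        conj (((2 * z.im * Complex.I : ℂ) ^ (2 * m))⁻¹) * f z) * f z =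
      8 * Real.pi / ((2 * m : ℕ) - 1) * ((2 * z.im * Complex.I : ℂ) ^ (2 * m))⁻¹ *
        ((∑ f ∈ B, z.im ^ (2 * m) * ‖f z‖ ^ 2 : ℝ) : ℂ) := by
    rw [Complex.ofReal_sum, Finset.mul_sum]
    refine Finset.sum_congr rfl fun f _ => ?_
    have h4 : ((‖f z‖ ^ 2 : ℝ) : ℂ) = conj (f z) * f z := by
      rw [← Complex.normSq_eq_norm_sq, Complex.normSq_eq_conj_mul_self]
    have h5 : conj (8 * Real.pi / (((2 * m : ℕ) : ℂ) - 1)) =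
        8 * Real.pi / (((2 * m : ℕ) : ℂ) - 1) := by
      simp only [map_div₀, map_mul, map_sub, map_natCast, map_one, map_ofNat, Complex.conj_ofReal]
    rw [Complex.ofReal_mul, h4, map_mul, map_mul, map_mul, h5, Complex.conj_conj, map_pow,
      Complex.conj_ofReal]
    push_cast
    ring
  rw [h2, h3] at h1
  simp_rw [div_pow, inv_div, div_eq_mul_inv _ (_ ^ (2 * m)), tsum_mul_left, h1]
  field_simp

end ModularAverage

end

/-! ### Pointwise bounds for the terms of the kernel -/

noncomputable section

namespace ModularAverage

open UpperHalfPlane Set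
open scoped ComplexConjugate

/-- The square of `cosh (dist z (γ • z) / 2)`. -/
def coshSq (z : ℍ) (γ : SL(2, ℤ)) : ℝ := ‖pairing z γ z‖ ^ 2 / (4 * z.im ^ 2)

/-- The two summands come from the imaginary part (a + d) Im z and the real part of `pairing z γ z`.
-/
lemma coshSq_eq (z : ℍ) (γ : SL(2, ℤ)) :
    coshSq z γ = ((γ 0 0 + γ 1 1 : ℤ) : ℝ) ^ 2 / 4 +
      ((γ 0 0 - γ 1 1 : ℤ) * z.re + γ 0 1 - γ 1 0 * (z.re ^ 2 + z.im ^ 2)) ^ 2 /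
        (4 * z.im ^ 2) := by
  have hz := z.im_ne_zero
  rw [coshSq, ← Complex.normSq_eq_norm_sq]
  simp [pairing, pairingSlope, pairingConst, Complex.normSq_apply]
  field_simp
  ring

/-- For c ≠ 0 the determinant eliminates b. Only t = a + d, u = cx - (a - d) / 2 and s = cy remain,
the variables in which the sum factors. -/
lemma coshSq_eq_of_ne_zero (z : ℍ) (γ : SL(2, ℤ)) (hc : γ 1 0 ≠ 0) :
    coshSq z γ = ((γ 0 0 + γ 1 1 : ℤ) : ℝ) ^ 2 / 4 +
      ((γ 1 0 * z.re - (γ 0 0 - γ 1 1 : ℤ) / 2) ^ 2 + (γ 1 0 * z.im) ^ 2 + 1 -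
        ((γ 0 0 + γ 1 1 : ℤ) : ℝ) ^ 2 / 4) ^ 2 / (4 * (γ 1 0 * z.im) ^ 2) := by
  have hz := z.im_ne_zero
  have hc' : (γ 1 0 : ℝ) ≠ 0 := by exact_mod_cast hc
  have hdet : (γ 0 0 * γ 1 1 - γ 0 1 * γ 1 0 : ℝ) = 1 := by exact_mod_cast det_eq_one γ
  have h : (γ 1 0 * z.re - (γ 0 0 - γ 1 1 : ℤ) / 2 : ℝ) ^ 2 + (γ 1 0 * z.im) ^ 2 + 1 -
        ((γ 0 0 + γ 1 1 : ℤ) : ℝ) ^ 2 / 4 =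
      -(γ 1 0 : ℝ) * ((γ 0 0 - γ 1 1 : ℤ) * z.re + γ 0 1 -
        γ 1 0 * (z.re ^ 2 + z.im ^ 2)) := by
    push_cast
    linear_combination -hdet
  rw [coshSq_eq, h, mul_pow, mul_pow, neg_sq]
  field_simp

lemma norm_term_eq (m : ℕ) (z : ℍ) (γ : SL(2, ℤ)) :
    ‖((pairing z γ z / (2 * z.im * Complex.I)) ^ (2 * m))⁻¹‖ = (coshSq z γ ^ m)⁻¹ := by
  rw [norm_inv, norm_pow, pow_mul, norm_div, div_pow, coshSq]
  congr 4
  simp [mul_pow]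
  norm_num

/-- The estimate of a term of the kernel that is used for small traces. -/
lemma inv_pow_le_of_abs_le_two {t u s W : ℝ} {m : ℕ} (hm : 2 ≤ m) (hs : 0 < s) (ht : t ^ 2 ≤ 4)
    (hW : W = t ^ 2 / 4 + (u ^ 2 + s ^ 2 + 1 - t ^ 2 / 4) ^ 2 / (4 * s ^ 2)) :
    (W ^ m)⁻¹ ≤ 480 / s ^ 2 * (1 / (1 + t ^ 2)) * (1 / (1 + m * u ^ 2)) := by
  set D := 1 - t ^ 2 / 4 with hD
  have hD0 : 0 ≤ D := by linarith
  have h1 : 1 + u ^ 2 / 2 ≤ W := by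
    have : W = 1 + u ^ 2 / 2 + ((s ^ 2 - D) ^ 2 + u ^ 4 + 2 * u ^ 2 * D) / (4 * s ^ 2) := by
      rw [hW, show u ^ 2 + s ^ 2 + 1 - t ^ 2 / 4 = u ^ 2 + s ^ 2 + D by rw [hD]; ring,
        show t ^ 2 / 4 = 1 - D by rw [hD]; ring]
      field_simp
      ring
    rw [this]
    have : 0 ≤ ((s ^ 2 - D) ^ 2 + u ^ 4 + 2 * u ^ 2 * D) / (4 * s ^ 2) := by positivity
    linarith
  have h2 : s ^ 2 / 4 ≤ W := by
    have h3 : s ^ 2 / 4 = (s ^ 2) ^ 2 / (4 * s ^ 2) := by field_simp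
    have h4 : (s ^ 2) ^ 2 ≤ (u ^ 2 + s ^ 2 + 1 - t ^ 2 / 4) ^ 2 := by
      apply pow_le_pow_left₀ (by positivity)
      nlinarith [sq_nonneg u]
    rw [hW, h3]
    have : (s ^ 2) ^ 2 / (4 * s ^ 2) ≤ (u ^ 2 + s ^ 2 + 1 - t ^ 2 / 4) ^ 2 / (4 * s ^ 2) := by
      gcongr
    nlinarith [sq_nonneg t]
  -- One factor `W` is spent on s² / 4, and Bernoulli's inequality applies to the remaining m - 1.
  obtain ⟨n, rfl⟩ := Nat.exists_eq_add_of_le' hm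
  have h3 : 1 + (n + 1) * (u ^ 2 / 2) ≤ W ^ (n + 1) := by
    have := one_add_mul_le_pow (a := u ^ 2 / 2) (by nlinarith [sq_nonneg u]) (n + 1)
    push_cast at this
    exact this.trans (pow_le_pow_left₀ (by positivity) h1 _)
  have h4 : s ^ 2 / 4 * (1 + (n + 1) * (u ^ 2 / 2)) ≤ W ^ (n + 2) := by
    rw [pow_succ' W (n + 1)]
    have : 0 < W := by nlinarith [sq_nonneg u]
    gcongr
  have h5 : (1 + ((n + 2 : ℕ) : ℝ) * u ^ 2) ≤ 4 * (1 + (n + 1) * (u ^ 2 / 2)) := by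
    push_cast
    nlinarith [mul_nonneg (Nat.cast_nonneg (α := ℝ) n) (sq_nonneg u), sq_nonneg u]
  calc (W ^ (n + 2))⁻¹ ≤ (s ^ 2 / 4 * (1 + (n + 1) * (u ^ 2 / 2)))⁻¹ := by gcongr
    _ = 4 / s ^ 2 * (1 / (1 + (n + 1) * (u ^ 2 / 2))) := by field_simp
    _ ≤ 4 / s ^ 2 * (4 / (1 + ((n + 2 : ℕ) : ℝ) * u ^ 2)) := by
        gcongr ?_ * ?_
        rw [div_le_div_iff₀ (by positivity) (by positivity)]
        linarith
    _ = 16 / s ^ 2 * 1 * (1 / (1 + ((n + 2 : ℕ) : ℝ) * u ^ 2)) := by ring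
    -- Here 1 + t² ≤ 5. The wasteful 30 gives 16 · 30 = 480, the constant of the case of large
    -- traces.
    _ ≤ 16 / s ^ 2 * (30 / (1 + t ^ 2)) * (1 / (1 + ((n + 2 : ℕ) : ℝ) * u ^ 2)) := by
        gcongr
        rw [le_div_iff₀ (by positivity)]
        linarith
    _ = _ := by ring

/-- The estimate of a term of the kernel that is used for large traces. -/
lemma inv_pow_le_of_three_le_abs {t u s W : ℝ} {m : ℕ} (hm : 3 ≤ m) (hs : 0 < s) (ht : 9 ≤ t ^ 2)
    (hW : W = t ^ 2 / 4 + (u ^ 2 + s ^ 2 + 1 - t ^ 2 / 4) ^ 2 / (4 * s ^ 2)) :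
    (W ^ m)⁻¹ ≤ 480 / s ^ 2 * (1 / (1 + t ^ 2)) * (1 / (1 + m * u ^ 2)) := by
  have h0 : t ^ 2 / 4 ≤ W := by
    rw [hW]
    have : 0 ≤ (u ^ 2 + s ^ 2 + 1 - t ^ 2 / 4) ^ 2 / (4 * s ^ 2) := by positivity
    linarith
  have hW0 : 9 / 4 ≤ W := by linarith
  have h1 : (u ^ 2 + s ^ 2 + 1 - t ^ 2 / 4) ^ 2 ≤ 4 * s ^ 2 * W := by
    have : 4 * s ^ 2 * W = s ^ 2 * t ^ 2 + (u ^ 2 + s ^ 2 + 1 - t ^ 2 / 4) ^ 2 := by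
      rw [hW]; field_simp
    rw [this]
    nlinarith [mul_nonneg (sq_nonneg s) (sq_nonneg t)]
  -- The inequality of arithmetic and geometric means: 2s√W ≤ s² / 2 + 2W.
  have h2 : u ^ 2 + s ^ 2 + 1 - t ^ 2 / 4 ≤ s ^ 2 / 2 + 2 * W := by
    refine abs_le_of_sq_le_sq' (h1.trans ?_) (by positivity) |>.2
    nlinarith [sq_nonneg (s ^ 2 / 2 - 2 * W)]
  have h3 : u ^ 2 + s ^ 2 / 2 ≤ 3 * W := by linarith
  have h4 : s ^ 2 / 6 ≤ W := by nlinarith [sq_nonneg u]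
  have h5 : (1 + u ^ 2) / 4 ≤ W := by nlinarith [sq_nonneg s]
  have h6 : (1 + t ^ 2) / 5 ≤ W := by linarith
  -- Three factors `W` pay for s², 1 + u² and 1 + t². The remaining m - 3 give the factor m / 4, as
  -- W ≥ 9 / 4. The constant is 4 · 6 · 4 · 5 = 480.
  obtain ⟨n, rfl⟩ := Nat.exists_eq_add_of_le' hm
  have h7 : ((n + 3 : ℕ) : ℝ) / 4 ≤ W ^ n := by
    have h8 := one_add_mul_le_pow (a := (5 / 4 : ℝ)) (by norm_num) n
    have h9 : (1 + 5 / 4 : ℝ) ^ n ≤ W ^ n := pow_le_pow_left₀ (by norm_num) (by linarith) n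
    push_cast
    nlinarith [Nat.cast_nonneg (α := ℝ) n]
  have hWp : 0 < W := by linarith
  have h10 : ((n + 3 : ℕ) : ℝ) / 4 * (s ^ 2 / 6 * ((1 + u ^ 2) / 4) * ((1 + t ^ 2) / 5)) ≤
      W ^ (n + 3) := by
    rw [pow_add, show W ^ 3 = W * W * W by ring]
    gcongr
  have h11 : 1 + ((n + 3 : ℕ) : ℝ) * u ^ 2 ≤ ((n + 3 : ℕ) : ℝ) * (1 + u ^ 2) := by
    push_cast
    nlinarith [Nat.cast_nonneg (α := ℝ) n]
  calc (W ^ (n + 3))⁻¹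
      ≤ (((n + 3 : ℕ) : ℝ) / 4 * (s ^ 2 / 6 * ((1 + u ^ 2) / 4) * ((1 + t ^ 2) / 5)))⁻¹ := by
        gcongr
    _ = 480 / s ^ 2 * (1 / (1 + t ^ 2)) * (1 / (((n + 3 : ℕ) : ℝ) * (1 + u ^ 2))) := by
        field_simp
        norm_num
    _ ≤ _ := by gcongr

/-- A term of the kernel that does not fix the cusp `∞`. -/
lemma inv_coshSq_pow_le {m : ℕ} (hm : 3 ≤ m) (z : ℍ) (γ : SL(2, ℤ)) (hc : γ 1 0 ≠ 0) :
    (coshSq z γ ^ m)⁻¹ ≤ 480 / (γ 1 0 * z.im) ^ 2 *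
      (1 / (1 + ((γ 0 0 + γ 1 1 : ℤ) : ℝ) ^ 2)) *
      (1 / (1 + m * (γ 1 0 * z.re - (γ 0 0 - γ 1 1 : ℤ) / 2) ^ 2)) := by
  have hW := coshSq_eq_of_ne_zero z γ hc
  have hs : 0 < |(γ 1 0 : ℝ) * z.im| :=
    abs_pos.mpr (mul_ne_zero (by exact_mod_cast hc) z.im_ne_zero)
  rw [← sq_abs (γ 1 0 * z.im)] at hW ⊢
  rcases le_or_gt (|γ 0 0 + γ 1 1|) 2 with h | h
  · refine inv_pow_le_of_abs_le_two (by omega) hs ?_ hW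
    have : (|γ 0 0 + γ 1 1|) ^ 2 ≤ 2 ^ 2 := pow_le_pow_left₀ (abs_nonneg _) h 2
    rw [sq_abs] at this
    exact_mod_cast this
  · refine inv_pow_le_of_three_le_abs hm hs ?_ hW
    have : 3 ^ 2 ≤ (|γ 0 0 + γ 1 1|) ^ 2 := pow_le_pow_left₀ (by norm_num) h 2
    rw [sq_abs] at this
    exact_mod_cast this

/-- A term of the kernel that fixes the cusp `∞`. -/
lemma coshSq_of_eq_zero (z : ℍ) (γ : SL(2, ℤ)) (hc : γ 1 0 = 0) :
    coshSq z γ = 1 + (γ 0 1 : ℝ) ^ 2 / (4 * z.im ^ 2) := by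
  have hdet := det_eq_one γ
  rw [hc, mul_zero, sub_zero] at hdet
  rw [coshSq_eq, hc]
  rcases Int.eq_one_or_neg_one_of_mul_eq_one' hdet with ⟨h1, h2⟩ | ⟨h1, h2⟩ <;>
  · rw [h1, h2]
    push_cast
    ring

end ModularAverage

end

/-! ### Summing the kernel over a horocycle -/

noncomputable section

namespace ModularAverage

open UpperHalfPlane Set

/-- The integral of a periodization over a period. -/
lemma lintegral_tsum_sub_intCast {φ : ℝ → ℝ≥0∞} (hφ : Measurable φ) :
    ∫⁻ x in Ioc (0 : ℝ) 1, ∑' n : ℤ, φ (x - n) = ∫⁻ x, φ x := by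
  have h : ∫⁻ x, φ x = ∑' n : ℤ, ∫⁻ x in Ioc (n : ℝ) (n + 1), φ x := by
    rw [← lintegral_iUnion (fun _ => measurableSet_Ioc) (pairwise_disjoint_Ioc_intCast ℝ),
      iUnion_Ioc_intCast, setLIntegral_univ]
  rw [lintegral_tsum (f := fun (n : ℤ) x => φ (x - n)) fun n => (by fun_prop), h,
    ← (Equiv.neg ℤ).tsum_eq]
  refine tsum_congr fun n => ?_
  rw [← lintegral_indicator measurableSet_Ioc, ← lintegral_indicator measurableSet_Ioc,
    ← lintegral_add_right_eq_self ((Ioc (n : ℝ) (n + 1)).indicator φ) (n : ℝ)]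
  refine lintegral_congr fun x => ?_
  simp only [indicator, mem_Ioc, Equiv.neg_apply, Int.cast_neg, sub_neg_eq_add]
  refine if_congr ⟨fun h => ⟨?_, ?_⟩, fun h => ⟨?_, ?_⟩⟩ rfl rfl <;> linarith [h.1, h.2]

/-- The sum over a periodizes φ. Multiplication by c ≠ 0 and translation by h both preserve Lebesgue
measure on the circle, so the result depends on neither. -/
lemma tsum_lintegral_mul_sub {φ : ℝ → ℝ≥0∞} (hφ : Measurable φ) {c : ℤ} (hc : c ≠ 0) (h : ℝ) :
    ∑' a : ℤ, ∫⁻ x in Ioc (0 : ℝ) 1, φ (c * x - a + h) = ∫⁻ x, φ x := by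
  set G : ℝ → ℝ≥0∞ := fun v => ∑' a : ℤ, φ (v - a) with hG
  have hGm : Measurable G :=
    Measurable.tsum fun a => hφ.comp (measurable_id.sub_const (a : ℝ))
  have hper : Function.Periodic G 1 := by
    intro v
    simp only [hG]
    rw [← (Equiv.addRight (1 : ℤ)).tsum_eq]
    refine tsum_congr fun a => ?_
    congr 1
    push_cast [Equiv.coe_addRight]
    ring
  have hliftm : Measurable (hper.lift : UnitAddCircle → ℝ≥0∞) := by
    have : (hper.lift : UnitAddCircle → ℝ≥0∞) =
        fun b => G (AddCircle.measurableEquivIoc 1 0 b) := by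
      ext b
      conv_lhs => rw [← AddCircle.coe_equivIoc (p := (1 : ℝ)) (a := 0) (y := b)]
      rw [Function.Periodic.lift_coe]
      rfl
    rw [this]
    exact hGm.comp (measurable_subtype_coe.comp (AddCircle.measurableEquivIoc 1 0).measurable)
  have hmp := Measure.measurePreserving_zsmul (volume : Measure UnitAddCircle) hc
  rw [← lintegral_tsum fun a => ?_]
  · calc ∫⁻ x in Ioc (0 : ℝ) 1, ∑' a : ℤ, φ (c * x - a + h)
        = ∫⁻ x in Ioc (0 : ℝ) (0 + 1), (fun b : UnitAddCircle => hper.lift (c • b + (h : ℝ))) x := by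
          rw [zero_add]
          refine lintegral_congr fun x => ?_
          have h1 : (c • (x : UnitAddCircle) + (h : ℝ) : UnitAddCircle) =
              ((c * x + h : ℝ) : UnitAddCircle) := by
            rw [← AddCircle.coe_zsmul, ← AddCircle.coe_add, zsmul_eq_mul]
          simp only [h1, Function.Periodic.lift_coe, hG]
          refine tsum_congr fun a => ?_
          congr 1
          ring
      _ = ∫⁻ b : UnitAddCircle, hper.lift (c • b + (h : ℝ)) :=
          UnitAddCircle.lintegral_preimage 0 fun b : UnitAddCircle => hper.lift (c • b + (h : ℝ))
      _ = ∫⁻ b : UnitAddCircle, hper.lift (b + (h : ℝ)) :=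
          hmp.lintegral_comp (f := fun b => hper.lift (b + (h : ℝ)))
            (hliftm.comp (measurable_id.add_const _))
      _ = ∫⁻ b : UnitAddCircle, hper.lift b := lintegral_add_right_eq_self _ _
      _ = ∫⁻ x in Ioc (0 : ℝ) (0 + 1), hper.lift (x : UnitAddCircle) :=
          (UnitAddCircle.lintegral_preimage 0 _).symm
      _ = ∫⁻ x, φ x := by
          simp only [Function.Periodic.lift_coe, zero_add, hG]
          exact lintegral_tsum_sub_intCast hφ
  · exact (hφ.comp (by fun_prop)).aemeasurable

lemma lintegral_one_div_one_add_mul_sq {m : ℕ} (hm : 0 < m) :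
    ∫⁻ x : ℝ, ENNReal.ofReal (1 / (1 + m * x ^ 2)) = ENNReal.ofReal (Real.pi / √m) := by
  have hm' : (0 : ℝ) < m := by exact_mod_cast hm
  have hs : 0 < √(m : ℝ) := Real.sqrt_pos.mpr hm'
  have h1 : ∀ x : ℝ, 1 / (1 + m * x ^ 2) = (1 + (√(m : ℝ) * x) ^ 2)⁻¹ := by
    intro x
    rw [mul_pow, Real.sq_sqrt hm'.le, one_div]
  simp_rw [h1]
  rw [← ofReal_integral_eq_lintegral_ofReal
    (integrable_inv_one_add_sq.comp_mul_left' hs.ne') (.of_forall fun x => by positivity),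
    Measure.integral_comp_mul_left (fun x : ℝ => (1 + x ^ 2)⁻¹), integral_univ_inv_one_add_sq,
    abs_of_pos (inv_pos.mpr hs), smul_eq_mul]
  congr 1
  field_simp

/-- The sum of `1 / n ^ 2` over the nonzero integers. -/
def sumInvSq : ℝ := ∑' n : ℤ, 1 / (n : ℝ) ^ 2

/-- The sum of `1 / (1 + n ^ 2)` over the integers. -/
def sumInvOneAddSq : ℝ := ∑' n : ℤ, 1 / (1 + (n : ℝ) ^ 2)

lemma summable_inv_sq : Summable fun n : ℤ => 1 / (n : ℝ) ^ 2 :=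
  Real.summable_one_div_int_pow.mpr one_lt_two

lemma summable_inv_one_add_sq : Summable fun n : ℤ => 1 / (1 + (n : ℝ) ^ 2) := by
  refine .of_norm_bounded_eventually summable_inv_sq ?_
  refine (Filter.eventually_cofinite_ne 0).mono fun n hn => ?_
  have : (0 : ℝ) < (n : ℝ) ^ 2 := by positivity
  rw [Real.norm_of_nonneg (by positivity)]
  gcongr
  linarith

lemma tsum_ofReal_inv_sq : ∑' n : ℤ, ENNReal.ofReal (1 / (n : ℝ) ^ 2) = ENNReal.ofReal sumInvSq :=
  (ENNReal.ofReal_tsum_of_nonneg (fun _ => by positivity) summable_inv_sq).symm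

lemma tsum_ofReal_inv_one_add_sq :
    ∑' n : ℤ, ENNReal.ofReal (1 / (1 + (n : ℝ) ^ 2)) = ENNReal.ofReal sumInvOneAddSq :=
  (ENNReal.ofReal_tsum_of_nonneg (fun _ => by positivity) summable_inv_one_add_sq).symm

lemma sumInvSq_nonneg : 0 ≤ sumInvSq := tsum_nonneg fun _ => by positivity

lemma sumInvOneAddSq_nonneg : 0 ≤ sumInvOneAddSq := tsum_nonneg fun _ => by positivity

/-- The contribution of the elements that do not fix the cusp `∞` to the kernel on a horocycle. -/
theorem lintegral_tsum_ne_zero_le {m : ℕ} (hm : 3 ≤ m) {y : ℝ} (hy : 0 < y) :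
    ∫⁻ x in Ioc (0 : ℝ) 1, ∑' γ : {γ : SL(2, ℤ) | γ 1 0 ≠ 0},
        ENNReal.ofReal ((coshSq (point y hy x) γ ^ m)⁻¹) ≤
      ENNReal.ofReal (480 * sumInvSq * sumInvOneAddSq * Real.pi / (y ^ 2 * √m)) := by
  set φ : ℝ → ℝ≥0∞ := fun u => ENNReal.ofReal (1 / (1 + m * u ^ 2)) with hφ
  have hφm : Measurable φ := by fun_prop
  set H : ℤ × ℤ × ℤ → ℝ≥0∞ := fun p => ENNReal.ofReal (480 / y ^ 2) *
    (ENNReal.ofReal (1 / (p.1 : ℝ) ^ 2) * (ENNReal.ofReal (1 / (1 + (p.2.1 : ℝ) ^ 2)) *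
      ∫⁻ x in Ioc (0 : ℝ) 1, φ (p.1 * x - p.2.2 + (p.2.1 : ℝ) / 2))) with hH
  have h1 : ∀ x : ℝ, ∀ γ : {γ : SL(2, ℤ) | γ 1 0 ≠ 0},
      ENNReal.ofReal ((coshSq (point y hy x) γ ^ m)⁻¹) ≤
      ENNReal.ofReal (480 / y ^ 2) * (ENNReal.ofReal (1 / (γ.1 1 0 : ℝ) ^ 2) *
        (ENNReal.ofReal (1 / (1 + ((γ.1 0 0 + γ.1 1 1 : ℤ) : ℝ) ^ 2)) *
          φ (γ.1 1 0 * x - γ.1 0 0 + ((γ.1 0 0 + γ.1 1 1 : ℤ) : ℝ) / 2))) := by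
    intro x γ
    have h2 := inv_coshSq_pow_le hm (point y hy x) γ.1 γ.2
    have hre : (point y hy x).re = x := by simp [point, UpperHalfPlane.re]
    have him : (point y hy x).im = y := by simp [point, UpperHalfPlane.im]
    rw [hre, him] at h2
    rw [hφ, ← ENNReal.ofReal_mul (by positivity), ← ENNReal.ofReal_mul (by positivity),
      ← ENNReal.ofReal_mul (by positivity)]
    refine ENNReal.ofReal_le_ofReal (h2.trans (le_of_eq ?_))
    push_cast
    rw [mul_pow]
    ring
  -- For c ≠ 0 the triple (c, a + d, a) determines d and then b. The sum over γ is enlarged to all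
  -- integer triples.
  have hinj : Function.Injective (fun γ : {γ : SL(2, ℤ) | γ 1 0 ≠ 0} =>
      ((γ.1 1 0, γ.1 0 0 + γ.1 1 1, γ.1 0 0) : ℤ × ℤ × ℤ)) := by
    rintro ⟨γ, hγ⟩ ⟨γ', hγ'⟩ h
    simp only [Prod.mk.injEq] at h
    obtain ⟨h1, h2, h3⟩ := h
    have h4 : γ 1 1 = γ' 1 1 := by linarith
    have h5 : γ 0 1 = γ' 0 1 := by
      have e1 := det_eq_one γ
      have e2 := det_eq_one γ'
      rw [h1, h3, h4] at e1
      exact mul_right_cancel₀ hγ' (by linarith)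
    ext i j
    fin_cases i <;> fin_cases j <;> simp [h1, h3, h4, h5]
  have hle : ∀ c : ℤ, ENNReal.ofReal (1 / (c : ℝ) ^ 2) * ∑' t : ℤ, ∑' a : ℤ,
      (ENNReal.ofReal (1 / (1 + (t : ℝ) ^ 2)) *
        ∫⁻ x in Ioc (0 : ℝ) 1, φ (c * x - a + (t : ℝ) / 2)) =
      ENNReal.ofReal (1 / (c : ℝ) ^ 2) *
        (ENNReal.ofReal sumInvOneAddSq * ENNReal.ofReal (Real.pi / √m)) := by
    intro c
    rcases eq_or_ne c 0 with rfl | hc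
    -- For c = 0 the factor 1 / 0 ^ 2 is 0 by convention.
    · simp
    · congr 1
      simp_rw [ENNReal.tsum_mul_left, tsum_lintegral_mul_sub hφm hc, ENNReal.tsum_mul_right]
      rw [tsum_ofReal_inv_one_add_sq, hφ, lintegral_one_div_one_add_mul_sq (by omega)]
  calc _ ≤ ∫⁻ x in Ioc (0 : ℝ) 1, ∑' γ : {γ : SL(2, ℤ) | γ 1 0 ≠ 0},
        ENNReal.ofReal (480 / y ^ 2) * (ENNReal.ofReal (1 / (γ.1 1 0 : ℝ) ^ 2) *
        (ENNReal.ofReal (1 / (1 + ((γ.1 0 0 + γ.1 1 1 : ℤ) : ℝ) ^ 2)) *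
          φ (γ.1 1 0 * x - γ.1 0 0 + ((γ.1 0 0 + γ.1 1 1 : ℤ) : ℝ) / 2))) :=
        lintegral_mono fun x => ENNReal.tsum_le_tsum (h1 x)
    _ = ∑' γ : {γ : SL(2, ℤ) | γ 1 0 ≠ 0}, H (γ.1 1 0, γ.1 0 0 + γ.1 1 1, γ.1 0 0) := by
        rw [lintegral_tsum fun γ => (by fun_prop)]
        refine tsum_congr fun γ => ?_
        rw [lintegral_const_mul _ (by fun_prop), lintegral_const_mul _ (by fun_prop),
          lintegral_const_mul _ (by fun_prop)]
    _ ≤ ∑' p, H p := ENNReal.tsum_comp_le_tsum_of_injective hinj H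
    _ = ENNReal.ofReal (480 / y ^ 2) * (ENNReal.ofReal sumInvSq *
          (ENNReal.ofReal sumInvOneAddSq * ENNReal.ofReal (Real.pi / √m))) := by
        rw [ENNReal.tsum_prod']
        simp_rw [ENNReal.tsum_prod', hH, ENNReal.tsum_mul_left]
        simp_rw [ENNReal.tsum_mul_left] at hle
        simp_rw [hle, ENNReal.tsum_mul_right, tsum_ofReal_inv_sq]
    _ = _ := by
        have := sumInvSq_nonneg
        have := sumInvOneAddSq_nonneg
        rw [← ENNReal.ofReal_mul (by positivity), ← ENNReal.ofReal_mul (by positivity),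
          ← ENNReal.ofReal_mul (by positivity)]
        congr 1
        field_simp

/-- The contribution of the elements that fix the cusp `∞`. -/
theorem tsum_eq_zero_le {m : ℕ} {z : ℍ} {σ δ : ℝ} (hσ : 0 < σ) (hz : σ ≤ 1 / (4 * z.im ^ 2))
    (hδ : ((1 + σ) ^ m)⁻¹ ≤ δ) :
    ∑' γ : {γ : SL(2, ℤ) | γ 1 0 = 0 ∧ γ ≠ 1 ∧ γ ≠ -1},
        ENNReal.ofReal ((coshSq z γ ^ (m + 1))⁻¹) ≤
      ENNReal.ofReal (2 * (δ / σ) * sumInvSq) := by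
  have hδ0 : 0 ≤ δ := le_trans (by positivity) hδ
  have hunit : ∀ γ : SL(2, ℤ), γ 1 0 = 0 → (γ 0 0 = 1 ∧ γ 1 1 = 1) ∨ (γ 0 0 = -1 ∧ γ 1 1 = -1) := by
    intro γ hc
    have hdet := det_eq_one γ
    rw [hc, mul_zero, sub_zero] at hdet
    exact Int.eq_one_or_neg_one_of_mul_eq_one' hdet
  -- The boolean records the common sign of the diagonal entries, the integer is b.
  set H : Bool × ℤ → ℝ≥0∞ := fun p => ENNReal.ofReal (δ / σ) * ENNReal.ofReal (1 / (p.2 : ℝ) ^ 2)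
    with hH
  have hinj : Function.Injective (fun γ : {γ : SL(2, ℤ) | γ 1 0 = 0 ∧ γ ≠ 1 ∧ γ ≠ -1} =>
      ((decide (γ.1 0 0 = 1), γ.1 0 1) : Bool × ℤ)) := by
    rintro ⟨γ, hγ, hγ1⟩ ⟨γ', hγ', hγ1'⟩ h
    simp only [Prod.mk.injEq, decide_eq_decide] at h
    obtain ⟨h1, h2⟩ := h
    have h3 : γ 0 0 = γ' 0 0 ∧ γ 1 1 = γ' 1 1 := by
      rcases hunit γ hγ with ⟨e1, e2⟩ | ⟨e1, e2⟩ <;>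
      rcases hunit γ' hγ' with ⟨e3, e4⟩ | ⟨e3, e4⟩ <;> simp_all
    ext i j
    fin_cases i <;> fin_cases j <;> simp [h2, h3, hγ, hγ']
  have hterm : ∀ γ : {γ : SL(2, ℤ) | γ 1 0 = 0 ∧ γ ≠ 1 ∧ γ ≠ -1},
      ENNReal.ofReal ((coshSq z γ ^ (m + 1))⁻¹) ≤ H (decide (γ.1 0 0 = 1), γ.1 0 1) := by
    rintro ⟨γ, hc, hne1, hne2⟩
    have hb : γ 0 1 ≠ 0 := by
      intro hb
      rcases hunit γ hc with ⟨e1, e2⟩ | ⟨e1, e2⟩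
      · exact hne1 (by ext i j; fin_cases i <;> fin_cases j <;> simp [hb, hc, e1, e2])
      · exact hne2 (by ext i j; fin_cases i <;> fin_cases j <;> simp [hb, hc, e1, e2])
    have hb1 : (1 : ℝ) ≤ (γ 0 1 : ℝ) ^ 2 := by
      have : (1 : ℤ) ≤ (γ 0 1) ^ 2 := by
        have := sq_nonneg (γ 0 1)
        have := pow_ne_zero 2 hb
        omega
      exact_mod_cast this
    simp only [hH]
    rw [← ENNReal.ofReal_mul (by positivity)]
    refine ENNReal.ofReal_le_ofReal ?_
    have h1 : 1 + (γ 0 1 : ℝ) ^ 2 * σ ≤ coshSq z γ := by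
      rw [coshSq_of_eq_zero z γ hc, div_eq_mul_one_div]
      gcongr
    have h2 : 1 + σ ≤ coshSq z γ := by nlinarith
    have h3 : (γ 0 1 : ℝ) ^ 2 * σ ≤ coshSq z γ := by linarith
    have h4 : 0 < (γ 0 1 : ℝ) ^ 2 * σ := by nlinarith
    have h5 : 0 < coshSq z γ := by linarith
    -- The first m factors give the small δ. The last one gives the decay b⁻² needed for summation.
    calc (coshSq z γ ^ (m + 1))⁻¹ = (coshSq z γ ^ m)⁻¹ * (coshSq z γ)⁻¹ := by
          rw [pow_succ, mul_inv]
      _ ≤ ((1 + σ) ^ m)⁻¹ * ((γ 0 1 : ℝ) ^ 2 * σ)⁻¹ := by gcongr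
      _ ≤ δ * ((γ 0 1 : ℝ) ^ 2 * σ)⁻¹ := by gcongr
      _ = _ := by field_simp
  calc _ ≤ ∑' γ : {γ : SL(2, ℤ) | γ 1 0 = 0 ∧ γ ≠ 1 ∧ γ ≠ -1},
        H (decide (γ.1 0 0 = 1), γ.1 0 1) := ENNReal.tsum_le_tsum hterm
    _ ≤ ∑' p, H p := ENNReal.tsum_comp_le_tsum_of_injective hinj H
    _ = 2 * (ENNReal.ofReal (δ / σ) * ENNReal.ofReal sumInvSq) := by
        rw [ENNReal.tsum_prod', tsum_bool]
        simp only [hH, ENNReal.tsum_mul_left, tsum_ofReal_inv_sq]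
        rw [two_mul]
    _ = _ := by
        rw [← ENNReal.ofReal_mul (by positivity), mul_assoc, ENNReal.ofReal_mul zero_le_two,
          ENNReal.ofReal_ofNat]

end ModularAverage

end

/-! ### The dimension count and the L¹ bound for the density -/

noncomputable section

namespace ModularAverage

open UpperHalfPlane Set
open scoped ComplexConjugate

/-- In weight at least 3 the cusp forms have codimension 1 in the modular forms, so the level one
dimension formula applies. -/
lemma finrank_cuspForm_bounds {k : ℕ} (hk : 3 ≤ k) (hk2 : Even k) :
    k / 12 ≤ Module.finrank ℂ (CuspForm 𝒮ℒ (k : ℤ)) + 1 ∧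
      Module.finrank ℂ (CuspForm 𝒮ℒ (k : ℤ)) ≤ k / 12 := by
  have h1 := ModularForm.rank_eq_one_add_rank_cuspForm hk hk2
  rw [ModularForm.dimension_level_one k hk2] at h1
  have h2 : Module.rank ℂ (CuspForm 𝒮ℒ (k : ℤ)) < Cardinal.aleph0 := by
    have : (1 : Cardinal) + Module.rank ℂ (CuspForm 𝒮ℒ (k : ℤ)) < Cardinal.aleph0 := by
      rw [← h1]
      exact Cardinal.natCast_lt_aleph0
    exact (Cardinal.add_lt_aleph0_iff.mp this).2
  obtain ⟨d, hd⟩ := Cardinal.lt_aleph0.mp h2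
  rw [Module.finrank_eq_of_rank_eq hd]
  rw [hd] at h1
  have h3 : (if k ≡ 2 [MOD 12] then k / 12 else k / 12 + 1) = 1 + d := by exact_mod_cast h1
  split_ifs at h3 <;> omega

lemma IsOrthonormalBasis.card_bounds {k : ℕ} (hk : 3 ≤ k) (hk2 : Even k)
    {B : Finset (CuspForm 𝒮ℒ (k : ℤ))} (hB : IsOrthonormalBasis B) :
    (k : ℝ) - 24 ≤ 12 * B.card ∧ 12 * (B.card : ℝ) ≤ k := by
  have h := finrank_cuspForm_bounds hk hk2
  rw [hB.finrank_eq_card] at h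
  have h1 : k ≤ 12 * B.card + 24 := by omega
  have h2 : 12 * B.card ≤ k := by omega
  have h3 : (k : ℝ) ≤ 12 * B.card + 24 := by exact_mod_cast h1
  exact ⟨by linarith, by exact_mod_cast h2⟩

/-- The deviation of the Bergman kernel on the diagonal from the contribution of `1` and `-1`. -/
theorem enorm_kernel_sub_le {k m : ℕ} (hm : 3 ≤ m) (hkm : k = 2 * m)
    {B : Finset (CuspForm 𝒮ℒ (k : ℤ))} (hB : IsOrthonormalBasis B) (z : ℍ) :
    ‖∑ f ∈ B, z.im ^ k * ‖f z‖ ^ 2 - (k - 1) / (4 * Real.pi)‖ₑ ≤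
      ENNReal.ofReal ((k - 1) / (8 * Real.pi)) *
        ((∑' γ : {γ : SL(2, ℤ) | γ 1 0 ≠ 0}, ENNReal.ofReal ((coshSq z γ ^ m)⁻¹)) +
          ∑' γ : {γ : SL(2, ℤ) | γ 1 0 = 0 ∧ γ ≠ 1 ∧ γ ≠ -1},
            ENNReal.ofReal ((coshSq z γ ^ m)⁻¹)) := by
  subst hkm
  classical
  set T : SL(2, ℤ) → ℂ := fun γ => ((pairing z γ z / (2 * z.im * Complex.I)) ^ (2 * m))⁻¹ with hT
  have hI : (2 * z.im * Complex.I : ℂ) ≠ 0 := by simp [z.im_ne_zero]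
  have hsum : Summable T := by
    refine ((summable_pairing hm z z).mul_left ((2 * z.im * Complex.I : ℂ) ^ (2 * m))).congr
      fun γ => ?_
    rw [hT]
    simp only [div_pow, inv_div]
    rw [div_eq_mul_inv]
  have hp1 : pairing z 1 z = 2 * z.im * Complex.I := by
    have : (z : ℂ) - conj (z : ℂ) = 2 * z.im * Complex.I := by
      rw [Complex.sub_conj]
      simp
    rw [← this]
    simp [pairing, pairingSlope, pairingConst]
    ring
  have hp2 : pairing z (-1) z = -(2 * z.im * Complex.I) := by
    rw [← hp1]
    simp [pairing, pairingSlope, pairingConst]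
    ring
  -- The terms at 1 and -1 are both 1, as the exponent 2m is even. Together they are the main term.
  have hT1 : T 1 = 1 := by
    simp only [hT, hp1, div_self hI, one_pow, inv_one]
  have hT2 : T (-1) = 1 := by
    simp only [hT, hp2, neg_div, div_self hI]
    rw [pow_mul]
    norm_num
  have hne : (1 : SL(2, ℤ)) ≠ -1 := by
    intro h
    have := congrArg (fun g : SL(2, ℤ) => g.val 0 0) h
    simp at this
  have hsplit := hsum.sum_add_tsum_compl (s := {1, -1})
  rw [Finset.sum_pair hne, hT1, hT2] at hsplit
  have hker := bergman_kernel_eq hm hB z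
  rw [← hsplit] at hker
  set R : ℂ := ∑' γ : ↥((({1, -1} : Finset SL(2, ℤ)) : Set SL(2, ℤ))ᶜ), T γ with hR
  have hm1 : (0 : ℝ) ≤ ((2 * m : ℕ) : ℝ) - 1 := by
    rw [sub_nonneg]
    exact_mod_cast (by omega : 1 ≤ 2 * m)
  have hpi := Real.pi_pos
  have h1 : ((∑ f ∈ B, z.im ^ (2 * m) * ‖f z‖ ^ 2 - ((2 * m : ℕ) - 1) / (4 * Real.pi) : ℝ) : ℂ) =
      (((2 * m : ℕ) - 1) / (8 * Real.pi) : ℝ) * R := by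
    rw [Complex.ofReal_sub, hker]
    push_cast
    ring
  have h2 : ‖R‖ₑ ≤ (∑' γ : {γ : SL(2, ℤ) | γ 1 0 ≠ 0}, ENNReal.ofReal ((coshSq z γ ^ m)⁻¹)) +
      ∑' γ : {γ : SL(2, ℤ) | γ 1 0 = 0 ∧ γ ≠ 1 ∧ γ ≠ -1},
        ENNReal.ofReal ((coshSq z γ ^ m)⁻¹) := by
    refine enorm_tsum_le_tsum_enorm.trans ?_
    have h3 : ∀ γ, ‖T γ‖ₑ = ENNReal.ofReal ((coshSq z γ ^ m)⁻¹) := by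
      intro γ
      rw [← ofReal_norm, hT, norm_term_eq]
    simp_rw [h3]
    refine le_trans (ENNReal.tsum_mono_subtype (fun γ => ENNReal.ofReal ((coshSq z γ ^ m)⁻¹))
      (t := {γ : SL(2, ℤ) | γ 1 0 ≠ 0} ∪ {γ : SL(2, ℤ) | γ 1 0 = 0 ∧ γ ≠ 1 ∧ γ ≠ -1}) ?_)
      (ENNReal.tsum_union_le (fun γ => ENNReal.ofReal ((coshSq z γ ^ m)⁻¹)) _ _)
    intro γ hγ
    simp only [Finset.coe_insert, Finset.coe_singleton, mem_compl_iff, mem_insert_iff,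
      mem_singleton_iff, not_or] at hγ
    by_cases hc : γ 1 0 = 0
    · exact .inr ⟨hc, hγ⟩
    · exact .inl hc
  rw [← ofReal_norm, ← Complex.norm_real, h1, norm_mul, Complex.norm_real,
    Real.norm_of_nonneg (by positivity), ENNReal.ofReal_mul (by positivity), ofReal_norm]
  gcongr

/-- With σ = 17 log k / k ≤ 1 one has log(1 + σ) ≥ σ / 2, so n log(1 + σ) ≥ kσ / 8 = (17 / 8) log k.
Any constant from 16 on would give the exponent 2. -/
lemma inv_one_add_log_div_pow_le {k n : ℕ} (hk : 2000 ≤ k) (hn : k ≤ 4 * n) :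
    ((1 + 17 * Real.log k / k) ^ n)⁻¹ ≤ ((k : ℝ) ^ 2)⁻¹ := by
  have hk' : (2000 : ℝ) ≤ k := by exact_mod_cast hk
  have hn' : (k : ℝ) ≤ 4 * n := by exact_mod_cast hn
  have hk0 : (0 : ℝ) < k := by linarith
  have hlog : 0 ≤ Real.log k := Real.log_nonneg (by linarith)
  -- From log k = 2 log √k ≤ 2√k, it is enough that √k ≥ 34.
  have hlogle : 17 * Real.log k ≤ k := by
    have h1 : Real.log k = 2 * Real.log √k := by
      rw [Real.log_sqrt hk0.le]; ring
    have h2 := Real.log_le_sub_one_of_pos (Real.sqrt_pos.mpr hk0)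
    have h3 : √(k : ℝ) ^ 2 = k := Real.sq_sqrt hk0.le
    have h4 : 34 ≤ √(k : ℝ) := Real.le_sqrt_of_sq_le (by linarith)
    nlinarith
  set σ := 17 * Real.log k / k with hσ
  have hσ0 : 0 ≤ σ := by positivity
  have hσ1 : σ ≤ 1 := (div_le_one hk0).mpr hlogle
  have h1 : σ / 2 ≤ Real.log (1 + σ) := by
    refine le_trans ?_ (Real.one_sub_inv_le_log_of_pos (by linarith : 0 < 1 + σ))
    have : 1 - (1 + σ)⁻¹ = σ / (1 + σ) := by
      field_simp
      ring
    rw [this]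
    gcongr
    linarith
  have h2 : 2 * Real.log k ≤ n * Real.log (1 + σ) := by
    have h3 : (k : ℝ) / 4 * (σ / 2) ≤ n * Real.log (1 + σ) := by
      gcongr
      linarith
    have h4 : (k : ℝ) / 4 * (σ / 2) = 17 / 8 * Real.log k := by
      rw [hσ]
      field_simp
      ring
    linarith
  gcongr
  rw [← Real.log_le_log_iff (by positivity) (by positivity), Real.log_pow, Real.log_pow]
  exact_mod_cast h2

/-- The constant of the main estimate. -/
def deviationConst : ℝ :=
  2 * (480 * sumInvSq * sumInvOneAddSq * Real.pi) + 2 * sumInvSq + 50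

lemma deviationConst_pos : 0 < deviationConst := by
  have := sumInvSq_nonneg
  have := sumInvOneAddSq_nonneg
  have := Real.pi_pos
  unfold deviationConst
  positivity

/-- The `L ^ 1` distance of the density on a horocycle to the constant `3 / π`. -/
theorem lintegral_density_sub_le {k : ℕ} (hk : 2000 ≤ k) (hk2 : Even k)
    {B : Finset (CuspForm 𝒮ℒ (k : ℤ))} (hB : IsOrthonormalBasis B) {y : ℝ} (hy : 0 < y) {Y : ℝ}
    (hY : 1 ≤ Y) (hYy : Y⁻¹ < y) (hyk : 17 * Real.log k / k ≤ 1 / (4 * y ^ 2)) :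
    ∫⁻ x in Ioc (0 : ℝ) 1, ‖density B y hy x - 3 / Real.pi‖ₑ ≤
      ENNReal.ofReal (deviationConst * Y ^ 2 * (√k)⁻¹) := by
  have hk' : (2000 : ℝ) ≤ k := by exact_mod_cast hk
  have hk0 : (0 : ℝ) < k := by linarith
  have hcard := hB.card_bounds (by omega) hk2
  have hpi := Real.pi_pos
  have hpi3 := Real.pi_gt_three
  set N : ℝ := (B.card : ℝ) with hN
  have hN0 : (k : ℝ) / 24 ≤ N := by linarith [hcard.1]
  have hNpos : 0 < N := by linarith
  have hlog1 : 1 ≤ Real.log k := by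
    rw [Real.le_log_iff_exp_le hk0]
    linarith [Real.exp_one_lt_d9]
  set σ := 17 * Real.log k / k with hσ
  have hσ0 : 0 < σ := by positivity
  obtain ⟨n, hkn⟩ : ∃ n, k = 2 * (n + 1) := by
    obtain ⟨r, hr⟩ := hk2
    exact ⟨r - 1, by omega⟩
  have hpow := inv_one_add_log_div_pow_le (k := k) (n := n) hk (by omega)
  set S : ℝ → ℝ≥0∞ := fun x => ∑' γ : {γ : SL(2, ℤ) | γ 1 0 ≠ 0},
    ENNReal.ofReal ((coshSq (point y hy x) γ ^ (n + 1))⁻¹) with hS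
  have him : ∀ x, (point y hy x).im = y := fun x => by simp [point, UpperHalfPlane.im]
  have hpt : ∀ x, ‖density B y hy x - 3 / Real.pi‖ₑ ≤
      S x + ENNReal.ofReal (2 * (((k : ℝ) ^ 2)⁻¹ / σ) * sumInvSq) + ENNReal.ofReal (50 / k) := by
    intro x
    set P : ℝ := ∑ f ∈ B, y ^ k * ‖f (point y hy x)‖ ^ 2 with hP
    have h1 := enorm_kernel_sub_le (m := n + 1) (by omega) hkn hB (point y hy x)
    have h2 := tsum_eq_zero_le (m := n) (z := point y hy x) hσ0 (by rw [him]; exact hyk) hpow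
    rw [him] at h1
    -- The second summand is the error of replacing 12|B| by k - 1, and its numerator is bounded by
    -- the dimension formula.
    have h3 : density B y hy x - 3 / Real.pi =
        N⁻¹ * (P - (k - 1) / (4 * Real.pi)) + (k - 1 - 12 * N) / (4 * Real.pi * N) := by
      change N⁻¹ * P - 3 / Real.pi = _
      field_simp
      ring
    have h4 : ‖(k - 1 - 12 * N) / (4 * Real.pi * N)‖ₑ ≤ ENNReal.ofReal (50 / k) := by
      rw [← ofReal_norm]
      refine ENNReal.ofReal_le_ofReal ?_
      rw [Real.norm_eq_abs, abs_div, abs_of_pos (show 0 < 4 * Real.pi * N by positivity),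
        div_le_div_iff₀ (by positivity) hk0]
      have h5 : |(k : ℝ) - 1 - 12 * N| ≤ 25 := by
        rw [abs_le]
        constructor <;> linarith [hcard.1, hcard.2]
      have h6 : (k : ℝ) / 2 ≤ 4 * Real.pi * N := by nlinarith
      nlinarith
    -- The normalised prefactor is at most 1 because N ≥ k / 24 and 8π ≥ 24.
    have h7 : ENNReal.ofReal N⁻¹ * ENNReal.ofReal ((k - 1) / (8 * Real.pi)) ≤ 1 := by
      rw [← ENNReal.ofReal_mul (by positivity), ENNReal.ofReal_le_one, inv_mul_le_iff₀ hNpos,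
        div_le_iff₀ (by positivity)]
      nlinarith
    rw [h3]
    refine (enorm_add_le _ _).trans (add_le_add ?_ h4)
    rw [enorm_mul, ← ofReal_norm N⁻¹, Real.norm_of_nonneg (by positivity)]
    calc _ ≤ ENNReal.ofReal N⁻¹ * (ENNReal.ofReal ((k - 1) / (8 * Real.pi)) * (S x +
          ENNReal.ofReal (2 * (((k : ℝ) ^ 2)⁻¹ / σ) * sumInvSq))) := by
          gcongr
          refine h1.trans ?_
          gcongr
      _ ≤ 1 * (S x + ENNReal.ofReal (2 * (((k : ℝ) ^ 2)⁻¹ / σ) * sumInvSq)) := by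
          rw [← mul_assoc]
          gcongr
      _ = _ := one_mul _
  have hss := sumInvSq_nonneg
  have hso := sumInvOneAddSq_nonneg
  have hsqrt : 0 < √(k : ℝ) := Real.sqrt_pos.mpr hk0
  have hinvk : 1 / (k : ℝ) ≤ (√k)⁻¹ := by
    rw [one_div]
    gcongr
    exact Real.sqrt_le_iff.mpr ⟨hk0.le, by nlinarith⟩
  have hY2 : 1 ≤ Y ^ 2 := one_le_pow₀ hY
  have hb1 : 480 * sumInvSq * sumInvOneAddSq * Real.pi / (y ^ 2 * √((n + 1 : ℕ) : ℝ)) ≤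
      2 * (480 * sumInvSq * sumInvOneAddSq * Real.pi) * Y ^ 2 * (√k)⁻¹ := by
    have h1 : (y ^ 2)⁻¹ ≤ Y ^ 2 := by
      rw [← inv_pow]
      have : y⁻¹ ≤ Y := inv_le_of_inv_le₀ (by positivity) hYy.le
      gcongr
    have h2 : (√((n + 1 : ℕ) : ℝ))⁻¹ ≤ 2 * (√k)⁻¹ := by
      have h3 : √(k : ℝ) ≤ 2 * √((n + 1 : ℕ) : ℝ) := by
        refine Real.sqrt_le_iff.mpr ⟨by positivity, ?_⟩
        rw [mul_pow, Real.sq_sqrt (by positivity), hkn]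
        push_cast
        nlinarith [Nat.cast_nonneg (α := ℝ) n]
      rw [← div_eq_mul_inv, le_div_iff₀ hsqrt, inv_mul_le_iff₀ (by positivity)]
      linarith
    calc _ = 480 * sumInvSq * sumInvOneAddSq * Real.pi * ((y ^ 2)⁻¹ * (√((n + 1 : ℕ) : ℝ))⁻¹) := by
          rw [← mul_inv, div_eq_mul_inv]
      _ ≤ 480 * sumInvSq * sumInvOneAddSq * Real.pi * (Y ^ 2 * (2 * (√k)⁻¹)) := by gcongr
      _ = _ := by ring
  have hb2 : 2 * (((k : ℝ) ^ 2)⁻¹ / σ) * sumInvSq ≤ 2 * sumInvSq * Y ^ 2 * (√k)⁻¹ := by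
    have h1 : ((k : ℝ) ^ 2)⁻¹ / σ ≤ 1 / k := by
      rw [hσ, div_le_div_iff₀ (by positivity) hk0]
      field_simp
      linarith
    calc _ ≤ 2 * (√k)⁻¹ * sumInvSq := by gcongr; exact h1.trans hinvk
      _ = 2 * sumInvSq * 1 * (√k)⁻¹ := by ring
      _ ≤ _ := by gcongr
  have hb3 : 50 / (k : ℝ) ≤ 50 * Y ^ 2 * (√k)⁻¹ := by
    calc 50 / (k : ℝ) = 50 * 1 * (1 / k) := by ring
      _ ≤ _ := by gcongr
  calc ∫⁻ x in Ioc (0 : ℝ) 1, ‖density B y hy x - 3 / Real.pi‖ₑ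
      ≤ ∫⁻ x in Ioc (0 : ℝ) 1, (S x + ENNReal.ofReal (2 * (((k : ℝ) ^ 2)⁻¹ / σ) * sumInvSq) +
          ENNReal.ofReal (50 / k)) := lintegral_mono hpt
    _ = (∫⁻ x in Ioc (0 : ℝ) 1, S x) + ENNReal.ofReal (2 * (((k : ℝ) ^ 2)⁻¹ / σ) * sumInvSq) +
          ENNReal.ofReal (50 / k) := by
        rw [lintegral_add_right _ measurable_const, lintegral_add_right _ measurable_const]
        simp
    _ ≤ ENNReal.ofReal (2 * (480 * sumInvSq * sumInvOneAddSq * Real.pi) * Y ^ 2 * (√k)⁻¹) +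
          ENNReal.ofReal (2 * sumInvSq * Y ^ 2 * (√k)⁻¹) +
          ENNReal.ofReal (50 * Y ^ 2 * (√k)⁻¹) := by
        gcongr
        exact (lintegral_tsum_ne_zero_le (by omega) hy).trans (ENNReal.ofReal_le_ofReal hb1)
    _ = _ := by
        rw [← ENNReal.ofReal_add (by positivity) (by positivity),
          ← ENNReal.ofReal_add (by positivity) (by positivity), deviationConst]
        congr 1
        ring

end ModularAverage

end

/-! ### Passage to the circle and the final estimate -/

noncomputable section

namespace ModularAverage

open UpperHalfPlane Set

section Circle

variable {k : ℕ} (B : Finset (CuspForm 𝒮ℒ (k : ℤ))) (y : ℝ) (hy : 0 < y)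

lemma continuous_point : Continuous (point y hy) :=
  continuous_induced_rng.mpr (by
    change Continuous fun x : ℝ => (x : ℂ) + y * Complex.I
    fun_prop)

lemma continuous_density : Continuous (density B y hy) := by
  refine continuous_const.mul (continuous_finsetSum _ fun f _ => continuous_const.mul ?_)
  exact ((continuous_cuspForm f).comp (continuous_point y hy)).norm.pow 2

lemma density_nonneg (x : ℝ) : 0 ≤ density B y hy x :=
  mul_nonneg (by positivity) (Finset.sum_nonneg fun f _ => by positivity)

/-- The density on the circle. -/
def circleDensity (t : UnitAddCircle) : ℝ := (density_periodic B y hy).lift t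

@[simp] lemma circleDensity_coe (x : ℝ) :
    circleDensity B y hy (x : UnitAddCircle) = density B y hy x :=
  Function.Periodic.lift_coe _ x

lemma continuous_circleDensity : Continuous (circleDensity B y hy) :=
  continuous_coinduced_dom.mpr (continuous_density B y hy)

lemma circleDensity_nonneg (t : UnitAddCircle) : 0 ≤ circleDensity B y hy t := by
  induction t using QuotientAddGroup.induction_on with
  | H x => exact density_nonneg B y hy x

lemma exists_circleDensity_bound : ∃ M, ∀ t, ‖circleDensity B y hy t‖ ≤ M := by
  obtain ⟨M, hM⟩ := isCompact_univ.exists_bound_of_continuousOn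
    (continuous_circleDensity B y hy).continuousOn
  exact ⟨M, fun t => hM t trivial⟩

lemma integrable_circleDensity_smul {ψ : UnitAddCircle → ℂ} (hψ : Integrable ψ) :
    Integrable fun t => (circleDensity B y hy t : ℂ) * ψ t := by
  obtain ⟨M, hM⟩ := exists_circleDensity_bound B y hy
  refine hψ.bdd_mul (c := M) ?_ (.of_forall fun t => by simpa using hM t)
  exact (Complex.continuous_ofReal.comp (continuous_circleDensity B y hy)).aestronglyMeasurable

lemma toNNReal_smul_eq (ψ : UnitAddCircle → ℂ) (t : UnitAddCircle) :
    (circleDensity B y hy t).toNNReal • ψ t = (circleDensity B y hy t : ℂ) * ψ t := by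
  rw [NNReal.smul_def, Real.coe_toNNReal _ (circleDensity_nonneg B y hy t), Complex.real_smul]

lemma integrable_horizontalMeasure {ψ : UnitAddCircle → ℂ} (hψ : Integrable ψ) :
    Integrable ψ (horizontalMeasure B y hy) := by
  refine (integrable_withDensity_iff_integrable_smul
    (continuous_circleDensity B y hy).measurable.real_toNNReal).mpr ?_
  simp_rw [toNNReal_smul_eq]
  exact integrable_circleDensity_smul B y hy hψ

lemma integral_horizontalMeasure (ψ : UnitAddCircle → ℂ) :
    ∫ t, ψ t ∂(horizontalMeasure B y hy) = ∫ t, (circleDensity B y hy t : ℂ) * ψ t := by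
  refine (integral_withDensity_eq_integral_smul
    (continuous_circleDensity B y hy).measurable.real_toNNReal ψ).trans ?_
  simp_rw [toNNReal_smul_eq]

/-- The deviation from equidistribution is bounded by the `L ^ 1` norm of the deviation of the
density. -/
theorem enorm_integral_sub_le (c : ℝ) {ψ : UnitAddCircle → ℂ} (hψ : Integrable ψ) :
    ‖(∫ t, ψ t ∂(horizontalMeasure B y hy)) - (c : ℂ) * ∫ t, ψ t‖ₑ ≤
      (∫⁻ x in Ioc (0 : ℝ) 1, ‖density B y hy x - c‖ₑ) * eLpNorm ψ ∞ volume := by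
  rw [integral_horizontalMeasure, ← integral_const_mul,
    ← integral_sub (integrable_circleDensity_smul B y hy hψ) (hψ.const_mul _)]
  have h1 : ∫⁻ x in Ioc (0 : ℝ) 1, ‖density B y hy x - c‖ₑ =
      ∫⁻ t : UnitAddCircle, ‖circleDensity B y hy t - c‖ₑ := by
    rw [← UnitAddCircle.lintegral_preimage 0, zero_add]
    simp
  have hm : Measurable fun t : UnitAddCircle => ‖circleDensity B y hy t - c‖ₑ :=
    ((continuous_circleDensity B y hy).sub continuous_const).enorm.measurable
  rw [h1, ← lintegral_mul_const _ hm, eLpNorm_exponent_top]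
  refine (enorm_integral_le_lintegral_enorm _).trans (lintegral_mono_ae ?_)
  refine (ae_le_eLpNormEssSup (f := ψ) (μ := volume)).mono fun t ht => ?_
  rw [← sub_mul, enorm_mul, ← Complex.ofReal_sub]
  have h2 : ‖((circleDensity B y hy t - c : ℝ) : ℂ)‖ₑ = ‖circleDensity B y hy t - c‖ₑ := by
    rw [← ofReal_norm, Complex.norm_real, ofReal_norm]
  rw [h2]
  gcongr

end Circle

/-- Squaring gives 17 A y² log k ≤ k, and A ≥ 4 supplies the 4 of 1 / (4y²), the quantity that
controls the terms with c = 0. -/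
lemma log_div_le_of_lt_rpow {A y : ℝ} {k : ℕ} (hA : 4 ≤ A) (hk : 2000 ≤ k) (hy : 0 < y)
    (h : y < (k : ℝ) ^ (1 / 2 : ℝ) * (17 * A * Real.log k) ^ (-(1 / 2) : ℝ)) :
    17 * Real.log k / k ≤ 1 / (4 * y ^ 2) := by
  have hk' : (2000 : ℝ) ≤ k := by exact_mod_cast hk
  have hk0 : (0 : ℝ) < k := by linarith
  have hlog : 0 < Real.log k := Real.log_pos (by linarith)
  have hL : 0 < 17 * A * Real.log k := by positivity
  have h1 : y ^ 2 ≤ k / (17 * A * Real.log k) := by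
    have h2 : y ^ 2 ≤ ((k : ℝ) ^ (1 / 2 : ℝ) * (17 * A * Real.log k) ^ (-(1 / 2) : ℝ)) ^ 2 := by
      gcongr
    rwa [Real.rpow_neg hL.le, ← Real.sqrt_eq_rpow, ← Real.sqrt_eq_rpow, mul_pow, inv_pow,
      Real.sq_sqrt hk0.le, Real.sq_sqrt hL.le, ← div_eq_mul_inv] at h2
  rw [le_div_iff₀ hL] at h1
  rw [div_le_div_iff₀ hk0 (by positivity)]
  have h3 : y ^ 2 * (17 * 4 * Real.log k) ≤ y ^ 2 * (17 * A * Real.log k) := by gcongr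
  linarith

end ModularAverage

end

theorem theorem2 :
    ∃ A₀ Y₀ C : ℝ, ∃ k₀ : ℕ, 0 < A₀ ∧ 0 < Y₀ ∧ 0 < C ∧ 2 ≤ k₀ ∧
      ∀ A : ℝ, A₀ ≤ A → ∀ Y : ℝ, Y₀ ≤ Y → ∀ k : ℕ, k₀ ≤ k → Even k →
      ∀ B : Finset (CuspForm 𝒮ℒ (k : ℤ)), ModularAverage.IsOrthonormalBasis B →
      ∀ (y : ℝ) (hy : 0 < y), Y⁻¹ < y →
        y < (k : ℝ) ^ (1 / 2 : ℝ) * (17 * A * Real.log k) ^ (-(1 / 2) : ℝ) →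
      ∀ ψ : UnitAddCircle → ℂ, Integrable ψ volume →
        Integrable ψ (ModularAverage.horizontalMeasure B y hy) ∧
        ‖(∫ x, ψ x ∂(ModularAverage.horizontalMeasure B y hy))
            - ((3 / Real.pi : ℝ) : ℂ) * ∫ x, ψ x‖ₑ ≤
          ENNReal.ofReal
              (C * Y ^ 2 * (k : ℝ) ^ (-(1 / 2) : ℝ) * (Real.log k) ^ (1 / 2 : ℝ))
            * eLpNorm ψ ∞ volume := by
  -- Y ≥ 1 lets Y² absorb the error terms free of y. The threshold 2000 is generous: the strongest
  -- demand is k ≥ 34².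
  refine ⟨4, 1, ModularAverage.deviationConst, 2000, by norm_num, by norm_num,
    ModularAverage.deviationConst_pos, by norm_num, ?_⟩
  intro A hA Y hY k hk hk2 B hB y hy hYy hyk ψ hψ
  refine ⟨ModularAverage.integrable_horizontalMeasure B y hy hψ,
    (ModularAverage.enorm_integral_sub_le B y hy _ hψ).trans ?_⟩
  gcongr
  refine (ModularAverage.lintegral_density_sub_le hk hk2 hB hy hY hYy
    (ModularAverage.log_div_le_of_lt_rpow hA hk hy hyk)).trans (ENNReal.ofReal_le_ofReal ?_)
  have hk' : (2000 : ℝ) ≤ k := by exact_mod_cast hk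
  have hlog : 1 ≤ Real.log k := by
    rw [Real.le_log_iff_exp_le (by linarith)]
    linarith [Real.exp_one_lt_d9]
  -- The bound already holds without the logarithm, which is at least 1.
  have h1 : 1 ≤ (Real.log k) ^ (1 / 2 : ℝ) := Real.one_le_rpow hlog (by norm_num)
  rw [Real.rpow_neg (by positivity), ← Real.sqrt_eq_rpow]
  have := ModularAverage.deviationConst_pos
  exact le_mul_of_one_le_right (by positivity) h1
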